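/- Let $\mathbb F_q$ be a finite field, $n\ge 1$, $V=\mathbb F_q^n$ with standard basis $e_1,\dots,e_n$ and standard bilinear form $a\cdot b=\sum_i a_ib_i$; for $S\subset V$ put $S^\perp=\{u: u\cdot s=0\ \forall s\in S\}$. **Homology with local coefficients.** Let $X$ be a simplicial complex (including the empty simplex, of dimension $-1$) with ordered vertices. A local system $\mathcal F$ on $X$ assigns to each simplex $\sigma$ a module $\mathcal F(\sigma)$ and to each pair $\sigma\subset\tau$ a map $\rho_\sigma^\tau:\mathcal F(\tau)\to\mathcal F(\sigma)$, functorially. Let $C_k(X;\mathcal F)=\bigoplus_{\dim\sigma=k}\mathcal F(\sigma)\sigma$ for $k\ge -1$, with boundary $\partial_k(x\,\sigma)=\sum_{i=1}^{k+1}(-1)^{i+1}\rho^\sigma_{\sigma_i}(x)\,\sigma_i$, where $\sigma_i$ is $\sigma$ without its $i$-th vertex, and $\partial_{-1}=0$. The homology of $(C_k)_{k\ge-1}$ is $\tilde H_*(X;\mathcal F)$. A simplicial map $f:X\to Y$ that is strictly increasing on every simplex induces, for a local system $\mathcal G$ on $Y$ and $(f^{-1}\mathcal G)(\sigma)=\mathcal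 G(f(\sigma))$, a map $f_*:\tilde H_k(X;f^{-1}\mathcal G)\to\tilde H_k(Y;\mathcal G)$, $x\,\sigma\mapsto x\,f(\sigma)$. **The building.** Let $X_V$ be the order complex of the subspaces $0\ne U\subsetneq V$, ordered by inclusion, and let $\mathfrak g$ be the local system $\mathfrak g(U_1\subsetneq\cdots\subsetneq U_\ell)=U_1$, $\mathfrak g(\emptyset)=V$, with the inclusions as connecting maps. Put $\mathcal D^1(V)=\tilde H_{n-2}(X_V;\mathfrak g)$. **The complex $K$.** Let $a_1^0,a_1^1,\dots,a_{n-1}^0,a_{n-1}^1,b$ be distinct, let $M=\{a_1^0,a_1^1\}*\cdots*\{a_{n-1}^0,a_{n-1}^1\}$ be the octahedral $(n-2)$-sphere and $K=M\cup(\{b\}*M^{(n-3)})$, where $M^{(n-3)}$ is the $(n-3)$-skeleton. The simplices of the barycentric subdivision $\mathrm{sd}(K)$ are written $[\sigma_1,\dots,\sigma_{k+1}]$ with $\sigma_1\supsetneq\cdots\supsetneq\sigma_{k+1}$ nonempty simplices of $K$. For distinct vertices $x_1,\dots,x_{n-1}$ spanning a simplex of $K$ let $S(x)=[\{x_1,\dots,x_{n-1}\},\{x_1,\dots,x_{n-2}\},\dots,\{x_1\}]$,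 and for $\pi\in S_{n-1}$ let $\pi(x)=(x_{\pi(1)},\dots,x_{\pi(n-1)})$. For $\epsilon\in\{0,1\}^{n-1}$ let $a^\epsilon=(a_1^{\epsilon_1},\dots,a_{n-1}^{\epsilon_{n-1}})$, and let $a^{\epsilon,j}$ be $a^\epsilon$ with its $j$-th entry replaced by $b$. **The cycles.** Let $T_{q,n}$ be the set of sequences $v=(v_1,\dots,v_{n-1})\in V^{n-1}$ with $v_i\in e_i+\langle e_{i+1},\dots,e_n\rangle$ and $v_i\ne e_i$ for all $i$. For $v\in T_{q,n}$ define $\theta_v(a_i^0)=e_i$, $\theta_v(a_i^1)=v_i$, $\theta_v(b)=e_n$; then $f_v(\sigma)=\langle\theta_v(x):x\in\sigma\rangle^\perp$ defines a simplicial map $f_v:\mathrm{sd}(K)\to X_V$ that is strictly increasing on simplices. Let $v^\epsilon=(u_1,\dots,u_{n-1})$ with $u_i=e_i$ if $\epsilon_i=0$ and $u_i=v_i$ if $\epsilon_i=1$, let $w(v^\epsilon)$ be the unique $w\in\langle u_1,\dots,u_{n-1}\rangle^\perp$ with $w\cdot e_n=1$, and let $\chi(\epsilon,\pi)=(-1)^{\epsilon_1+\cdots+\epsilon_{n-1}}\mathrm{sgn}(\pi)$.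 Let $c_v\in C_{n-2}(\mathrm{sd}(K);f_v^{-1}\mathfrak g)$ be the chain with $$c_v(S(\pi(a^\epsilon)))=\chi(\epsilon,\pi)\,w(v^\epsilon),\qquad c_v(S(\pi(a^{\epsilon,j})))=\chi(\epsilon,\pi)\,\bigl(w(v^{\epsilon+e_j})-w(v^\epsilon)\bigr)\ \text{ if }\epsilon_j=0,$$ for all $\epsilon\in\{0,1\}^{n-1}$, $\pi\in S_{n-1}$, $1\le j\le n-1$ (here $\epsilon+e_j$ is $\epsilon$ with $j$-th entry changed to $1$). **Theorem.** Each $c_v$ is a cycle, and the classes $\tilde c_v=(f_v)_*c_v$, $v\in T_{q,n}$, form an $\mathbb F_q$-basis of $\mathcal D^1(V)=\tilde H_{n-2}(X_V;\mathfrak g)$. -/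

import Mathlib

noncomputable section

namespace TwistedBuilding

open scoped Classical DirectSum

/-! ### Simplicial complexes, local systems and reduced homology -/

/-- An abstract simplicial complex on vertices taken from `S`; the empty simplex is a simplex. -/
structure SimplicialCpx (S : Type*) where
  faces : Set (Finset S)
  empty_mem : ∅ ∈ faces
  down_closed : ∀ {σ τ : Finset S}, τ ∈ faces → σ ⊆ τ → σ ∈ faces

/-- A simplicial complex whose vertices carry an order relation that is a strict linear order on
each simplex.  Simplices are written with increasing vertices, so only the restriction of the order
to the simplices matters for the chain complex. -/
structure OrderedCpx (S : Type*) extends SimplicialCpx S where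
  lt : S → S → Prop
  lt_strict : ∀ σ ∈ faces, IsStrictTotalOrder {s : S // s ∈ σ} (fun s t => lt s.1 t.1)

/-- The order complex of a poset: the simplices are the finite chains. -/
def orderComplex (P : Type*) [PartialOrder P] : OrderedCpx P where
  faces := {σ | IsChain (· ≤ ·) (σ : Set P)}
  empty_mem := by simp
  down_closed := fun hτ hσ => hτ.mono (by exact_mod_cast hσ)
  lt := (· < ·)
  lt_strict := fun σ hσ =>
    { trichotomous := fun a b h1 h2 => by
        by_contra hne
        have hne' : a.1 ≠ b.1 := fun h => hne (Subtype.ext h)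
        rcases hσ a.2 b.2 hne' with h | h
        · exact h1 (lt_of_le_of_ne h hne')
        · exact h2 (lt_of_le_of_ne h hne'.symm)
      irrefl := fun a => lt_irrefl a.1
      trans := fun _ _ _ h1 h2 => lt_trans h1 h2 }

variable {S : Type*} {S' : Type*}

/-- The simplices with exactly `k` vertices, i.e. those of dimension `k - 1`. -/
@[ext]
structure OrderedCpx.Simplex (X : OrderedCpx S) (k : ℕ) where
  val : X.faces
  card_eq : val.1.card = k

/-- The face of `σ` opposite to its vertex `s`. -/
def OrderedCpx.Simplex.face {X : OrderedCpx S} {k : ℕ} (σ : X.Simplex (k + 1))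
    (s : {s : S // s ∈ σ.1.1}) : X.Simplex k :=
  ⟨⟨σ.1.1.erase s.1, X.down_closed σ.1.2 (Finset.erase_subset _ _)⟩, by
    rw [Finset.card_erase_of_mem s.2, σ.2]; rfl⟩

/-- If `s` is the `i`-th vertex of `σ` (counted from `1` in increasing order), this is
`(-1) ^ (i - 1) = (-1) ^ (i + 1)`. -/
def OrderedCpx.Simplex.sgn {X : OrderedCpx S} {k : ℕ} (σ : X.Simplex k)
    (s : {s : S // s ∈ σ.1.1}) : ℤ :=
  (-1) ^ (σ.1.1.filter (fun t => X.lt t s.1)).card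

/-- A local system of `R`-modules on a simplicial complex. -/
structure LocalSystem (R : Type*) [Ring R] (X : OrderedCpx S) where
  obj : X.faces → Type*
  [addCommGroup : ∀ σ, AddCommGroup (obj σ)]
  [module : ∀ σ, Module R (obj σ)]
  res : ∀ {σ τ : X.faces}, σ.1 ⊆ τ.1 → obj τ →ₗ[R] obj σ
  res_id : ∀ (σ : X.faces) (x : obj σ), res (Finset.Subset.refl σ.1) x = x
  res_comp : ∀ {η σ τ : X.faces} (h : η.1 ⊆ σ.1) (h' : σ.1 ⊆ τ.1) (x : obj τ),
    res h (res h' x) = res (h.trans h') x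

attribute [instance] LocalSystem.addCommGroup LocalSystem.module

namespace LocalSystem

variable {R : Type*} [Ring R] {X : OrderedCpx S} {Y : OrderedCpx S'}

/-- Twisted chains supported on the simplices with `k` vertices (degree `k - 1`). In particular
`Chain 0` is the group of chains of degree `-1`, supported on the empty simplex. -/
abbrev Chain (A : LocalSystem R X) (k : ℕ) : Type _ := ⨁ σ : X.Simplex k, A.obj σ.1

/-- The chain `x · σ`. -/
abbrev single (A : LocalSystem R X) {k : ℕ} (σ : X.Simplex k) : A.obj σ.1 →ₗ[R] A.Chain k :=
  DirectSum.lof R (X.Simplex k) (fun σ => A.obj σ.1) σ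

/-- The boundary map from degree `k` to degree `k - 1`. -/
def boundary (A : LocalSystem R X) (k : ℕ) : A.Chain (k + 1) →ₗ[R] A.Chain k :=
  DirectSum.toModule R (X.Simplex (k + 1)) (A.Chain k) fun σ =>
    ∑ s : {s : S // s ∈ σ.1.1},
      σ.sgn s • (A.single (σ.face s) ∘ₗ A.res (Finset.erase_subset s.1 σ.1.1))

theorem boundary_single (A : LocalSystem R X) {k : ℕ} (σ : X.Simplex (k + 1)) (x : A.obj σ.1) :
    A.boundary k (A.single σ x) = ∑ s : {s : S // s ∈ σ.1.1},
      σ.sgn s • A.single (σ.face s) (A.res (Finset.erase_subset s.1 σ.1.1) x) := by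
  rw [boundary, single, DirectSum.toModule_lof, LinearMap.sum_apply]
  rfl

/-- Cycles of degree `k - 1`; in degree `-1` every chain is a cycle. -/
def cycles (A : LocalSystem R X) : (k : ℕ) → Submodule R (A.Chain k)
  | 0 => ⊤
  | k + 1 => LinearMap.ker (A.boundary k)

/-- Boundaries of degree `k - 1`. -/
def boundaries (A : LocalSystem R X) (k : ℕ) : Submodule R (A.Chain k) :=
  LinearMap.range (A.boundary k)

/-- The reduced homology in degree `k - 1`: cycles modulo boundaries. -/
abbrev ReducedHomology (A : LocalSystem R X) (k : ℕ) : Type _ :=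
  A.cycles k ⧸ (A.boundaries k).comap (A.cycles k).subtype

/-- The homology class of a cycle. -/
def homologyClass (A : LocalSystem R X) {k : ℕ} (c : A.Chain k) (hc : c ∈ A.cycles k) :
    A.ReducedHomology k :=
  Submodule.Quotient.mk ⟨c, hc⟩

end LocalSystem

/-- A simplicial map that is strictly increasing on each simplex; in particular it preserves the
dimension of every simplex. -/
structure OrderedMap (X : OrderedCpx S) (Y : OrderedCpx S') where
  toFun : S → S'
  map_faces : ∀ σ ∈ X.faces, σ.image toFun ∈ Y.faces
  map_lt : ∀ σ ∈ X.faces, ∀ s ∈ σ, ∀ t ∈ σ, X.lt s t → Y.lt (toFun s) (toFun t)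

namespace OrderedMap

variable {R : Type*} [Ring R] {X : OrderedCpx S} {Y : OrderedCpx S'} (f : OrderedMap X Y)

theorem map_lt_iff {σ : Finset S} (hσ : σ ∈ X.faces) {s t : S} (hs : s ∈ σ) (ht : t ∈ σ) :
    Y.lt (f.toFun s) (f.toFun t) ↔ X.lt s t := by
  refine ⟨fun h => ?_, f.map_lt σ hσ s hs t ht⟩
  have hX := X.lt_strict σ hσ
  have hY := Y.lt_strict _ (f.map_faces σ hσ)
  have ms : f.toFun s ∈ σ.image f.toFun := Finset.mem_image_of_mem _ hs
  have mt : f.toFun t ∈ σ.image f.toFun := Finset.mem_image_of_mem _ ht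
  by_contra hn
  by_cases h' : X.lt t s
  · have h2 := f.map_lt σ hσ t ht s hs h'
    exact hY.irrefl ⟨_, ms⟩ (hY.trans ⟨_, ms⟩ ⟨_, mt⟩ ⟨_, ms⟩ h h2)
  · have : (⟨s, hs⟩ : {s : S // s ∈ σ}) = ⟨t, ht⟩ := hX.trichotomous _ _ hn h'
    have e : s = t := congrArg Subtype.val this
    subst e
    exact hY.irrefl ⟨_, ms⟩ h

theorem injOn {σ : Finset S} (hσ : σ ∈ X.faces) : Set.InjOn f.toFun (σ : Set S) := by
  intro s hs t ht h
  have hX := X.lt_strict σ hσ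
  have hY := Y.lt_strict _ (f.map_faces σ hσ)
  have mt : f.toFun t ∈ σ.image f.toFun := Finset.mem_image_of_mem _ ht
  have key : (⟨s, hs⟩ : {s : S // s ∈ σ}) = ⟨t, ht⟩ := by
    refine hX.trichotomous _ _ (fun h1 => ?_) (fun h1 => ?_)
    · have := f.map_lt σ hσ s hs t ht h1
      rw [h] at this
      exact hY.irrefl ⟨_, mt⟩ this
    · have := f.map_lt σ hσ t ht s hs h1
      rw [h] at this
      exact hY.irrefl ⟨_, mt⟩ this
  exact congrArg Subtype.val key

/-- The image of a simplex. -/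
def mapFace (σ : X.faces) : Y.faces := ⟨σ.1.image f.toFun, f.map_faces σ.1 σ.2⟩

/-- The image of a simplex with `k` vertices, again a simplex with `k` vertices. -/
abbrev mapSimplex {k : ℕ} (σ : X.Simplex k) : Y.Simplex k :=
  ⟨f.mapFace σ.1, (Finset.card_image_of_injOn (f.injOn σ.1.2)).trans σ.2⟩

/-- The inverse image of a local system, `(f⁻¹ A)(σ) = A (f σ)`. -/
abbrev pullback (A : LocalSystem R Y) : LocalSystem R X where
  obj σ := A.obj (f.mapFace σ)
  res h := A.res (Finset.image_subset_image h)
  res_id _ x := A.res_id _ x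
  res_comp _ _ x := A.res_comp _ _ x

/-- The map on chains induced by `f`: it sends `x · σ` to `x · f(σ)`. -/
def chainMap (A : LocalSystem R Y) (k : ℕ) : (f.pullback A).Chain k →ₗ[R] A.Chain k :=
  DirectSum.toModule R (X.Simplex k) (A.Chain k) fun σ => A.single (f.mapSimplex σ)

theorem chainMap_single (A : LocalSystem R Y) {k : ℕ} (σ : X.Simplex k)
    (x : (f.pullback A).obj σ.1) :
    f.chainMap A k ((f.pullback A).single σ x) = A.single (f.mapSimplex σ) x := by
  rw [chainMap, LocalSystem.single, DirectSum.toModule_lof]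

theorem single_congr (A : LocalSystem R Y) {k : ℕ} {τ τ' : Y.Simplex k} (h : τ = τ')
    {υ : Y.faces} (h1 : τ.1.1 ⊆ υ.1) (h2 : τ'.1.1 ⊆ υ.1) (x : A.obj υ) :
    A.single τ (A.res h1 x) = A.single τ' (A.res h2 x) := by
  subst h; rfl

theorem chainMap_boundary (A : LocalSystem R Y) (k : ℕ) (c : (f.pullback A).Chain (k + 1)) :
    f.chainMap A k ((f.pullback A).boundary k c) = A.boundary k (f.chainMap A (k + 1) c) := by
  suffices h : f.chainMap A k ∘ₗ (f.pullback A).boundary k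
      = A.boundary k ∘ₗ f.chainMap A (k + 1) from LinearMap.congr_fun h c
  refine DirectSum.linearMap_ext (M := fun σ : X.Simplex (k + 1) => (f.pullback A).obj σ.1) R
    fun σ => ?_
  refine LinearMap.ext fun x => ?_
  have hinj := f.injOn σ.1.2
  change f.chainMap A k ((f.pullback A).boundary k ((f.pullback A).single σ x))
    = A.boundary k (f.chainMap A (k + 1) ((f.pullback A).single σ x))
  rw [chainMap_single, LocalSystem.boundary_single, LocalSystem.boundary_single, map_sum]
  let e : {s : S // s ∈ σ.1.1} → {t : S' // t ∈ (f.mapSimplex σ).1.1} :=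
    fun s => ⟨f.toFun s.1, Finset.mem_image_of_mem _ s.2⟩
  have he : Function.Bijective e := by
    constructor
    · intro s t h
      exact Subtype.ext (hinj s.2 t.2 (congrArg Subtype.val h))
    · rintro ⟨t, ht⟩
      obtain ⟨s, hs, rfl⟩ := Finset.mem_image.1 ht
      exact ⟨⟨s, hs⟩, rfl⟩
  refine Fintype.sum_bijective (M := A.Chain k) e he _ _ fun s => ?_
  have hsgn : σ.sgn s = (f.mapSimplex σ).sgn (e s) := by
    unfold OrderedCpx.Simplex.sgn
    congr 1
    have : (f.mapSimplex σ).1.1.filter (fun t => Y.lt t (e s).1)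
        = (σ.1.1.filter (fun t => X.lt t s.1)).image f.toFun := by
      ext t
      simp only [Finset.mem_filter, Finset.mem_image]
      constructor
      · rintro ⟨ht, hlt⟩
        obtain ⟨u, hu, rfl⟩ := Finset.mem_image.1 ht
        exact ⟨u, ⟨hu, (f.map_lt_iff σ.1.2 hu s.2).1 hlt⟩, rfl⟩
      · rintro ⟨u, ⟨hu, hlt⟩, rfl⟩
        exact ⟨Finset.mem_image_of_mem _ hu, (f.map_lt_iff σ.1.2 hu s.2).2 hlt⟩
    rw [this, Finset.card_image_of_injOn]
    exact hinj.mono (by exact_mod_cast Finset.filter_subset _ _)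
  have hface : f.mapSimplex (σ.face s) = (f.mapSimplex σ).face (e s) := by
    apply OrderedCpx.Simplex.ext
    apply Subtype.ext
    change (σ.1.1.erase s.1).image f.toFun = (σ.1.1.image f.toFun).erase (f.toFun s.1)
    ext t
    simp only [Finset.mem_image, Finset.mem_erase]
    constructor
    · rintro ⟨u, ⟨hu, hm⟩, rfl⟩
      exact ⟨fun h => hu (hinj hm s.2 h), u, hm, rfl⟩
    · rintro ⟨ht, u, hm, rfl⟩
      exact ⟨u, ⟨fun h => ht (by rw [h]), hm⟩, rfl⟩
  rw [← hsgn, map_zsmul, chainMap_single]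
  congr 1
  exact single_congr A hface _ _ x

theorem chainMap_mem_cycles (A : LocalSystem R Y) (k : ℕ) :
    ∀ c ∈ (f.pullback A).cycles k, f.chainMap A k c ∈ A.cycles k := by
  cases k with
  | zero => intro c _; exact Submodule.mem_top
  | succ k =>
    intro c hc
    have hc' : (f.pullback A).boundary k c = 0 := hc
    change A.boundary k _ = 0
    rw [← f.chainMap_boundary, hc', map_zero]

/-- The map `f_*` induced on reduced homology. -/
def homologyMap (A : LocalSystem R Y) (k : ℕ) :
    (f.pullback A).ReducedHomology k →ₗ[R] A.ReducedHomology k :=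
  Submodule.mapQ _ _ ((f.chainMap A k).restrict (f.chainMap_mem_cycles A k)) (by
    rintro ⟨c, hc⟩ ⟨d, hd⟩
    exact ⟨f.chainMap A (k + 1) d, by rw [← f.chainMap_boundary, hd]; rfl⟩)

end OrderedMap

/-- The vertices of the barycentric subdivision of `K`: the nonempty simplices of `K`, the larger
ones coming first. -/
@[ext]
structure SdVertex (K : SimplicialCpx S) where
  val : Finset S
  property : val ∈ K.faces ∧ val.Nonempty

/-- Reverse inclusion. -/
instance (K : SimplicialCpx S) : PartialOrder (SdVertex K) :=
  PartialOrder.lift (fun σ => OrderDual.toDual σ.val) fun _ _ h => SdVertex.ext h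

/-- The barycentric subdivision of `K`. -/
abbrev sd (K : SimplicialCpx S) : OrderedCpx (SdVertex K) := orderComplex (SdVertex K)

/-! ### The building and its tautological local system

Throughout `n = m + 1` and `V = Fⁿ`, with coordinates indexed by `Fin (m + 1)`. -/

variable (F : Type*) [Field F] (m : ℕ)

/-- The nontrivial proper subspaces of `V`. -/
@[ext]
structure ProperSubspace where
  val : Submodule F (Fin (m + 1) → F)
  property : val ≠ ⊥ ∧ val ≠ ⊤

/-- Inclusion. -/
instance : PartialOrder (ProperSubspace F m) :=
  PartialOrder.lift ProperSubspace.val fun _ _ h => ProperSubspace.ext h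

/-- The building of `GL(V)`. -/
abbrev building : OrderedCpx (ProperSubspace F m) := orderComplex (ProperSubspace F m)

variable {F m}

/-- The smallest member of a flag, and `V` for the empty flag, written as the intersection of the
members of the flag. -/
def bottom (σ : Finset (ProperSubspace F m)) : Submodule F (Fin (m + 1) → F) where
  carrier := {u | ∀ U ∈ σ, u ∈ U.1}
  add_mem' := fun ha hb U hU => U.1.add_mem (ha U hU) (hb U hU)
  zero_mem' := fun U _ => U.1.zero_mem
  smul_mem' := fun c _ hx U hU => U.1.smul_mem c (hx U hU)

theorem bottom_empty : bottom (∅ : Finset (ProperSubspace F m)) = ⊤ :=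
  eq_top_iff.2 fun _ _ U hU => (Finset.notMem_empty U hU).elim

theorem bottom_eq {σ : Finset (ProperSubspace F m)} {U : ProperSubspace F m} (hU : U ∈ σ)
    (hmin : ∀ W ∈ σ, U ≤ W) : bottom σ = U.1 :=
  le_antisymm (fun _ hu => hu U hU) (fun _ hu W hW => hmin W hW hu)

theorem bottom_anti {σ τ : Finset (ProperSubspace F m)} (h : σ ⊆ τ) : bottom τ ≤ bottom σ :=
  fun _ hu U hU => hu U (h hU)

/-- The inclusion of the smallest members of flags. -/
def bottomIncl {σ τ : Finset (ProperSubspace F m)} (h : σ ⊆ τ) : bottom τ →ₗ[F] bottom σ :=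
  Submodule.inclusion (bottom_anti h)

theorem coe_bottomIncl {σ τ : Finset (ProperSubspace F m)} (h : σ ⊆ τ) (x : bottom τ) :
    (bottomIncl h x : Fin (m + 1) → F) = x :=
  Submodule.coe_inclusion (bottom_anti h) x

theorem bottomIncl_refl (σ : Finset (ProperSubspace F m)) (x : bottom σ) :
    bottomIncl (Finset.Subset.refl σ) x = x := rfl

theorem bottomIncl_comp {η σ τ : Finset (ProperSubspace F m)} (h : η ⊆ σ) (h' : σ ⊆ τ)
    (x : bottom τ) : bottomIncl h (bottomIncl h' x) = bottomIncl (h.trans h') x :=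
  Subtype.ext (by rw [coe_bottomIncl, coe_bottomIncl, coe_bottomIncl])

variable (F m) in
/-- The local system `𝔤`, with `𝔤(U₁ ⊂ ⋯ ⊂ U_ℓ) = U₁`, `𝔤(∅) = V`, and inclusions as connecting
maps. -/
abbrev taut : LocalSystem F (building F m) where
  obj σ := bottom σ.1
  res h := bottomIncl h
  res_id σ x := bottomIncl_refl σ.1 x
  res_comp h h' x := bottomIncl_comp h h' x

variable (F m) in
/-- `D¹(V)`: the reduced homology of the building in degree `n - 2` (simplices with `n - 1 = m`
vertices) with coefficients in `𝔤`. -/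
abbrev D1 : Type _ := (taut F m).ReducedHomology m

/-! ### The complex `K` -/

/-- The vertices `a_i^0 = a i false`, `a_i^1 = a i true` (for `i` in a set of size `m = n - 1`)
and `b`. -/
inductive Vertex (m : ℕ) : Type
  | a (i : Fin m) (ε : Bool) : Vertex m
  | b : Vertex m

/-- The octahedral sphere, the join of the `m` two-point complexes `{a_i^0, a_i^1}`. -/
def octahedron (m : ℕ) : SimplicialCpx (Vertex m) where
  faces := {σ | Vertex.b ∉ σ ∧ ∀ i, ¬ (Vertex.a i false ∈ σ ∧ Vertex.a i true ∈ σ)}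
  empty_mem := by simp
  down_closed := fun h hs => ⟨fun hb => h.1 (hs hb), fun i hi => h.2 i ⟨hs hi.1, hs hi.2⟩⟩

/-- `K = M ∪ ({b} * M^{(n-3)})`, with `M` the octahedral sphere; the simplices of the skeleton
`M^{(n-3)}` are those with fewer than `m = n - 1` vertices. -/
def coneComplex (m : ℕ) : SimplicialCpx (Vertex m) where
  faces := {σ | σ ∈ (octahedron m).faces ∨
    ∃ τ ∈ (octahedron m).faces, τ.card < m ∧ (σ = τ ∨ σ = insert Vertex.b τ)}
  empty_mem := Or.inl (octahedron m).empty_mem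
  down_closed := by
    rintro σ τ (h | ⟨ρ, h, hc, (rfl | rfl)⟩) hs
    · exact Or.inl ((octahedron m).down_closed h hs)
    · exact Or.inl ((octahedron m).down_closed h hs)
    · by_cases hb : Vertex.b ∈ σ
      · have hsub : σ.erase Vertex.b ⊆ ρ := fun x hx =>
          (Finset.mem_insert.1 (hs (Finset.mem_of_mem_erase hx))).resolve_left
            (Finset.ne_of_mem_erase hx)
        exact Or.inr ⟨σ.erase Vertex.b, (octahedron m).down_closed h hsub,
          (Finset.card_le_card hsub).trans_lt hc, Or.inr (Finset.insert_erase hb).symm⟩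
      · exact Or.inl ((octahedron m).down_closed h fun x hx =>
          (Finset.mem_insert.1 (hs hx)).resolve_left fun e => hb (e ▸ hx))

/-- For a sequence `x` of distinct vertices spanning a simplex, the vertex
`{x_1, …, x_{k+1}}` of the barycentric subdivision. -/
def prefixVertex {K : SimplicialCpx S} {k : ℕ} (x : Fin k → S)
    (hx : Finset.univ.image x ∈ K.faces) (i : Fin k) : SdVertex K :=
  ⟨(Finset.Iic i).image x,
    K.down_closed hx (Finset.image_subset_image (Finset.subset_univ _)),
    ⟨x i, Finset.mem_image_of_mem _ (Finset.mem_Iic.2 le_rfl)⟩⟩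

theorem prefixVertex_injective {K : SimplicialCpx S} {k : ℕ} (x : Fin k → S)
    (hx : Finset.univ.image x ∈ K.faces) (hinj : Function.Injective x) :
    Function.Injective (prefixVertex x hx) := by
  intro i j h
  have h' : (Finset.Iic i).image x = (Finset.Iic j).image x := congrArg SdVertex.val h
  have := Finset.image_injective hinj h'
  apply le_antisymm
  · exact Finset.mem_Iic.1 (this ▸ Finset.mem_Iic.2 le_rfl)
  · exact Finset.mem_Iic.1 (this ▸ Finset.mem_Iic.2 le_rfl)

/-- The simplex `S(x) = [{x_1, …, x_k}, {x_1, …, x_{k-1}}, …, {x_1}]`. -/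
def flagSimplex {K : SimplicialCpx S} {k : ℕ} (x : Fin k → S)
    (hx : Finset.univ.image x ∈ K.faces) (hinj : Function.Injective x) : (sd K).Simplex k :=
  ⟨⟨Finset.univ.image (prefixVertex x hx), by
    intro s hs t ht _
    obtain ⟨i, -, rfl⟩ := Finset.mem_image.1 (Finset.mem_coe.1 hs)
    obtain ⟨j, -, rfl⟩ := Finset.mem_image.1 (Finset.mem_coe.1 ht)
    rcases le_total i j with h | h
    · exact Or.inr (Finset.image_subset_image (Finset.Iic_subset_Iic.2 h))
    · exact Or.inl (Finset.image_subset_image (Finset.Iic_subset_Iic.2 h))⟩, by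
    rw [Finset.card_image_of_injective _ (prefixVertex_injective x hx hinj), Finset.card_univ,
      Fintype.card_fin]⟩

/-- The sequence `a^ε`. -/
def seqA (ε : Fin m → Bool) (i : Fin m) : Vertex m := Vertex.a i (ε i)

/-- The sequence `a^{ε,j}`, with `b` in place `j`. -/
def seqAB (ε : Fin m → Bool) (j : Fin m) (i : Fin m) : Vertex m :=
  if i = j then Vertex.b else Vertex.a i (ε i)

theorem seqA_injective (ε : Fin m → Bool) : Function.Injective (seqA ε) := by
  intro i j h
  simp only [seqA, Vertex.a.injEq] at h
  exact h.1

theorem seqAB_injective (ε : Fin m → Bool) (j : Fin m) : Function.Injective (seqAB ε j) := by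
  intro i i' h
  unfold seqAB at h
  split_ifs at h with h1 h2 h2
  · rw [h1, h2]
  · simp only [Vertex.a.injEq] at h
    exact h.1

theorem seqA_mem (ε : Fin m → Bool) (π : Equiv.Perm (Fin m)) :
    Finset.univ.image (seqA ε ∘ π) ∈ (coneComplex m).faces := by
  refine Or.inl ⟨by simp [seqA], fun i h => ?_⟩
  simp only [Finset.mem_image, Finset.mem_univ, true_and, Function.comp_apply, seqA,
    Vertex.a.injEq] at h
  obtain ⟨⟨j, h1, h2⟩, ⟨k, h3, h4⟩⟩ := h
  rw [h1] at h2
  rw [h3, h2] at h4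
  exact Bool.noConfusion h4

theorem seqAB_mem (ε : Fin m → Bool) (j : Fin m) (π : Equiv.Perm (Fin m)) :
    Finset.univ.image (seqAB ε j ∘ π) ∈ (coneComplex m).faces := by
  refine Or.inr ⟨(Finset.univ.erase j).image (seqA ε), ⟨by simp [seqA], fun i h => ?_⟩, ?_,
    Or.inr ?_⟩
  · simp only [Finset.mem_image, Finset.mem_erase, Finset.mem_univ, and_true, seqA,
      Vertex.a.injEq] at h
    obtain ⟨⟨j, -, h1, h2⟩, ⟨k, -, h3, h4⟩⟩ := h
    rw [h1] at h2
    rw [h3, h2] at h4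
    exact Bool.noConfusion h4
  · rw [Finset.card_image_of_injective _ (seqA_injective ε)]
    have := Finset.card_erase_lt_of_mem (Finset.mem_univ j)
    simpa using this
  · ext x
    simp only [Finset.mem_image, Finset.mem_univ, true_and, Function.comp_apply,
      Finset.mem_insert, Finset.mem_erase, and_true]
    constructor
    · rintro ⟨i, rfl⟩
      by_cases h : π i = j
      · exact Or.inl (by simp [seqAB, h])
      · exact Or.inr ⟨π i, h, by simp [seqAB, seqA, h]⟩
    · rintro (rfl | ⟨i, hi, rfl⟩)
      · exact ⟨π.symm j, by simp [seqAB]⟩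
      · exact ⟨π.symm i, by simp [seqAB, seqA, hi]⟩

/-! ### The index set, the simplicial map and the cycle -/

variable (F) in
/-- The standard basis vector. -/
def stdVec (p : Fin (m + 1)) : Fin (m + 1) → F := Pi.single p 1

variable (F m) in
/-- The set `T_{q,n}`: sequences `(v_1, …, v_{n-1})` with `v_i ∈ e_i + ⟨e_{i+1}, …, e_n⟩` and
`v_i ≠ e_i`. -/
abbrev IndexT : Type _ :=
  {v : Fin m → (Fin (m + 1) → F) // ∀ i : Fin m,
    v i - stdVec F i.castSucc ∈ Submodule.span F (stdVec F '' Set.Ioi i.castSucc) ∧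
    v i ≠ stdVec F i.castSucc}

/-- `S^⊥` with respect to the standard bilinear form. -/
def perp (A : Set (Fin (m + 1) → F)) : Submodule F (Fin (m + 1) → F) where
  carrier := {u | ∀ s ∈ A, u ⬝ᵥ s = 0}
  add_mem' := fun ha hb s hs => by rw [add_dotProduct, ha s hs, hb s hs, add_zero]
  zero_mem' := fun s _ => zero_dotProduct s
  smul_mem' := fun c x hx s hs => by rw [smul_dotProduct, hx s hs, smul_zero]

/-- The labelling of the vertices of `K` by vectors: `a_i^0 ↦ e_i`, `a_i^1 ↦ v_i`, `b ↦ e_n`. -/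
def theta (v : IndexT F m) : Vertex m → (Fin (m + 1) → F)
  | Vertex.a i false => stdVec F i.castSucc
  | Vertex.a i true => v.1 i
  | Vertex.b => stdVec F (Fin.last m)

/-- The position of the leading entry of `theta v x`. -/
def Vertex.pos : Vertex m → Fin (m + 1)
  | Vertex.a i _ => i.castSucc
  | Vertex.b => Fin.last m

theorem coord_eq_zero {q p : Fin (m + 1)} {u : Fin (m + 1) → F}
    (hu : u ∈ Submodule.span F (stdVec F '' Set.Ioi q)) (hp : p ≤ q) : u p = 0 := by
  have h : Submodule.span F (stdVec F '' Set.Ioi q)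
      ≤ LinearMap.ker (LinearMap.proj p : (Fin (m + 1) → F) →ₗ[F] F) := by
    rw [Submodule.span_le]
    rintro _ ⟨r, hr, rfl⟩
    exact Pi.single_eq_of_ne (hp.trans_lt hr).ne _
  exact h hu

theorem theta_lower (v : IndexT F m) (x : Vertex m) {p : Fin (m + 1)} (hp : p < x.pos) :
    theta v x p = 0 := by
  cases x with
  | a i ε =>
    cases ε with
    | false => exact Pi.single_eq_of_ne hp.ne _
    | true =>
      have h := coord_eq_zero (F := F) (v.2 i).1 hp.le
      have e : stdVec F i.castSucc p = 0 := Pi.single_eq_of_ne hp.ne _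
      rw [Pi.sub_apply, e, sub_zero] at h
      exact h
  | b => exact Pi.single_eq_of_ne hp.ne _

theorem theta_pos (v : IndexT F m) (x : Vertex m) : theta v x x.pos = 1 := by
  cases x with
  | a i ε =>
    cases ε with
    | false => exact Pi.single_eq_same _ _
    | true =>
      have h := coord_eq_zero (F := F) (v.2 i).1 le_rfl
      have e : stdVec F i.castSucc i.castSucc = 1 := Pi.single_eq_same _ _
      rw [Pi.sub_apply, e, sub_eq_zero] at h
      exact h
  | b => exact Pi.single_eq_same _ _

theorem exists_dual (v : IndexT F m) {σ : Finset (Vertex m)}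
    (hσ : Set.InjOn Vertex.pos (σ : Set (Vertex m))) (p : Fin (m + 1)) :
    ∃ w : Fin (m + 1) → F, w ≠ 0 ∧ ∀ x ∈ σ, w ⬝ᵥ theta v x = if x.pos = p then 1 else 0 := by
  let g : Fin (m + 1) → Fin (m + 1) → F := fun r =>
    if h : ∃ x ∈ σ, x.pos = r then theta v h.choose else stdVec F r
  have hg : ∀ x ∈ σ, g x.pos = theta v x := by
    intro x hx
    have h : ∃ y ∈ σ, y.pos = x.pos := ⟨x, hx, rfl⟩
    have e : h.choose = x := hσ h.choose_spec.1 hx h.choose_spec.2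
    simp only [g, dif_pos h, e]
  have hlow : ∀ r s, s < r → g r s = 0 := by
    intro r s hs
    by_cases h : ∃ x ∈ σ, x.pos = r
    · simp only [g, dif_pos h]
      exact theta_lower v _ (by rw [h.choose_spec.2]; exact hs)
    · simp only [g, dif_neg h]
      exact Pi.single_eq_of_ne hs.ne _
  have hdiag : ∀ r, g r r = 1 := by
    intro r
    by_cases h : ∃ x ∈ σ, x.pos = r
    · simp only [g, dif_pos h]
      have := theta_pos v h.choose
      rwa [h.choose_spec.2] at this
    · simp only [g, dif_neg h]
      exact Pi.single_eq_same _ _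
  have hdet : (Matrix.of g).det = 1 := by
    rw [Matrix.det_of_isUpperTriangular (M := Matrix.of g) (fun r s h => hlow r s h)]
    exact Finset.prod_eq_one fun r _ => hdiag r
  have hunit : IsUnit (Matrix.of g).det := by rw [hdet]; exact isUnit_one
  have hw : (Matrix.of g).mulVec ((Matrix.of g)⁻¹.mulVec (stdVec F p)) = stdVec F p := by
    rw [Matrix.mulVec_mulVec, Matrix.mul_nonsing_inv _ hunit, Matrix.one_mulVec]
  refine ⟨(Matrix.of g)⁻¹.mulVec (stdVec F p), fun h0 => ?_, fun x hx => ?_⟩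
  · rw [h0, Matrix.mulVec_zero] at hw
    have := congrFun hw p
    simp [stdVec] at this
  · have h := congrFun hw x.pos
    have h2 : (Matrix.of g).mulVec ((Matrix.of g)⁻¹.mulVec (stdVec F p)) x.pos
        = g x.pos ⬝ᵥ ((Matrix.of g)⁻¹.mulVec (stdVec F p)) := rfl
    rw [h2, hg x hx] at h
    rw [dotProduct_comm, h, stdVec, Pi.single_apply]

theorem pos_injOn {σ : Finset (Vertex m)} (hσ : σ ∈ (coneComplex m).faces) :
    Set.InjOn Vertex.pos (σ : Set (Vertex m)) := by
  have hoct : ∀ τ ∈ (octahedron m).faces, ∀ i ε δ, Vertex.a i ε ∈ τ → Vertex.a i δ ∈ τ → ε = δ := by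
    intro τ hτ i ε δ h1 h2
    cases ε <;> cases δ
    · rfl
    · exact (hτ.2 i ⟨h1, h2⟩).elim
    · exact (hτ.2 i ⟨h2, h1⟩).elim
    · rfl
  have hk : ∀ i ε δ, Vertex.a i ε ∈ σ → Vertex.a i δ ∈ σ → ε = δ := by
    rcases hσ with h | ⟨τ, h, -, (rfl | rfl)⟩
    · exact hoct σ h
    · exact hoct σ h
    · intro i ε δ h1 h2
      refine hoct τ h i ε δ ?_ ?_
      · exact (Finset.mem_insert.1 h1).resolve_left (by simp)
      · exact (Finset.mem_insert.1 h2).resolve_left (by simp)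
  intro x hx y hy hxy
  cases x with
  | a i ε =>
    cases y with
    | a j δ =>
      have e : i = j := Fin.castSucc_injective m hxy
      subst e
      rw [hk i ε δ hx hy]
    | b => exact ((Fin.castSucc_lt_last i).ne hxy).elim
  | b =>
    cases y with
    | a j δ => exact ((Fin.castSucc_lt_last j).ne hxy.symm).elim
    | b => rfl

theorem exists_pos_not_mem {σ : Finset (Vertex m)} (hσ : σ ∈ (coneComplex m).faces) :
    ∃ p, ∀ x ∈ σ, Vertex.pos x ≠ p := by
  by_contra hcon
  push Not at hcon
  have himg : σ.image Vertex.pos = Finset.univ := by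
    ext p
    obtain ⟨x, hx, hxp⟩ := hcon p
    simp only [Finset.mem_image, Finset.mem_univ, iff_true]
    exact ⟨x, hx, hxp⟩
  have hcard : m + 1 ≤ σ.card := by
    have := Finset.card_image_le (s := σ) (f := Vertex.pos)
    rw [himg, Finset.card_univ, Fintype.card_fin] at this
    exact this
  have hoct : Vertex.b ∉ σ → False := by
    intro hb
    obtain ⟨x, hx, hxp⟩ := hcon (Fin.last m)
    cases x with
    | a i ε => exact (Fin.castSucc_lt_last i).ne hxp
    | b => exact hb hx
  rcases hσ with h | ⟨τ, h, hc, (rfl | rfl)⟩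
  · exact hoct h.1
  · exact hoct h.1
  · have := Finset.card_insert_le Vertex.b τ
    omega

/-- The subspace `⟨θ(x) : x ∈ σ⟩^⊥`. -/
def perpTheta (v : IndexT F m) (σ : Finset (Vertex m)) : Submodule F (Fin (m + 1) → F) :=
  perp (Submodule.span F (theta v '' (σ : Set (Vertex m))) : Set (Fin (m + 1) → F))

theorem mem_perpTheta (v : IndexT F m) (σ : Finset (Vertex m)) (u : Fin (m + 1) → F) :
    u ∈ perpTheta v σ ↔ ∀ x ∈ σ, u ⬝ᵥ theta v x = 0 := by
  constructor
  · intro h x hx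
    exact h _ (Submodule.subset_span ⟨x, hx, rfl⟩)
  · intro h s hs
    have hle : Submodule.span F (theta v '' (σ : Set (Vertex m)))
        ≤ LinearMap.ker (dotProductBilin F F u) := by
      rw [Submodule.span_le]
      rintro _ ⟨x, hx, rfl⟩
      exact h x hx
    exact hle hs

theorem perpTheta_ne (v : IndexT F m) {σ : Finset (Vertex m)} (hσ : σ ∈ (coneComplex m).faces)
    (hne : σ.Nonempty) : perpTheta v σ ≠ ⊥ ∧ perpTheta v σ ≠ ⊤ := by
  constructor
  · obtain ⟨p, hp⟩ := exists_pos_not_mem hσ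
    obtain ⟨w, hw0, hw⟩ := exists_dual v (pos_injOn hσ) p
    intro h
    have hm : w ∈ perpTheta v σ := (mem_perpTheta v σ w).2 fun x hx => by
      rw [hw x hx, if_neg (hp x hx)]
    rw [h] at hm
    exact hw0 ((Submodule.mem_bot F).1 hm)
  · obtain ⟨x, hx⟩ := hne
    obtain ⟨w, -, hw⟩ := exists_dual v (pos_injOn hσ) x.pos
    intro h
    have hm : w ∈ perpTheta v σ := h ▸ Submodule.mem_top
    have h0 := (mem_perpTheta v σ w).1 hm x hx
    rw [hw x hx, if_pos rfl] at h0
    exact one_ne_zero h0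

theorem perpTheta_lt (v : IndexT F m) {σ τ : Finset (Vertex m)}
    (hτ : τ ∈ (coneComplex m).faces) (h : σ ⊂ τ) : perpTheta v τ < perpTheta v σ := by
  rw [Finset.ssubset_iff_exists_cons_subset] at h
  obtain ⟨x, hxσ, hsub⟩ := h
  have hxτ : x ∈ τ := hsub (Finset.mem_cons_self x σ)
  have hστ : σ ⊆ τ := fun y hy => hsub (Finset.mem_cons_of_mem hy)
  obtain ⟨w, -, hw⟩ := exists_dual v (pos_injOn hτ) x.pos
  refine lt_of_le_of_ne (fun u hu => ?_) fun heq => ?_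
  · rw [mem_perpTheta] at hu ⊢
    exact fun y hy => hu y (hστ hy)
  · have hm : w ∈ perpTheta v σ := (mem_perpTheta v σ w).2 fun y hy => by
      rw [hw y (hστ hy), if_neg]
      intro e
      exact hxσ (pos_injOn hτ (hστ hy) hxτ e ▸ hy)
    rw [← heq] at hm
    have h0 := (mem_perpTheta v τ w).1 hm x hxτ
    rw [hw x hxτ, if_pos rfl] at h0
    exact one_ne_zero h0

/-- The vertex map `σ ↦ ⟨θ(x) : x ∈ σ⟩^⊥`. -/
def fVertex (v : IndexT F m) (σ : SdVertex (coneComplex m)) : ProperSubspace F m :=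
  ⟨perpTheta v σ.1, perpTheta_ne v σ.2.1 σ.2.2⟩

theorem fVertex_lt (v : IndexT F m) {σ τ : SdVertex (coneComplex m)} (h : σ < τ) :
    fVertex v σ < fVertex v τ := by
  have h' : τ.1 ⊂ σ.1 := h
  exact perpTheta_lt v σ.2.1 h'

/-- The simplicial map `f_v : sd(K) → X_V`. -/
def fMap (v : IndexT F m) : OrderedMap (sd (coneComplex m)) (building F m) where
  toFun := fVertex v
  map_faces := by
    intro σ hσ s hs t ht _
    obtain ⟨i, hi, rfl⟩ := Finset.mem_image.1 (Finset.mem_coe.1 hs)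
    obtain ⟨j, hj, rfl⟩ := Finset.mem_image.1 (Finset.mem_coe.1 ht)
    have hmono : Monotone (fVertex v) := by
      intro a b hab
      rcases hab.eq_or_lt with rfl | h
      · exact le_rfl
      · exact (fVertex_lt v h).le
    rcases hσ.total hi hj with h | h
    · exact Or.inl (hmono h)
    · exact Or.inr (hmono h)
  map_lt := fun _ _ _ _ _ _ h => fVertex_lt v h

/-- The local system `𝔥_v = f_v⁻¹ 𝔤` on `sd(K)`. -/
abbrev hSystem (v : IndexT F m) : LocalSystem F (sd (coneComplex m)) := (fMap v).pullback (taut F m)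

/-- The sequence `v^ε`, with entries `e_i` where `ε_i = 0` and `v_i` where `ε_i = 1`. -/
def seqV (v : IndexT F m) (ε : Fin m → Bool) (i : Fin m) : Fin (m + 1) → F :=
  if ε i then v.1 i else stdVec F i.castSucc

/-- `w(u)`, the element `w` of `⟨u_1, …, u_{n-1}⟩^⊥` with `w · e_n = 1`. It exists and is unique
if `u_1, …, u_{n-1}, e_n` are linearly independent; `w(u) = 0` if there is no such element. -/
def wVec (u : Fin m → (Fin (m + 1) → F)) : Fin (m + 1) → F :=
  if h : ∃ w ∈ perp (Submodule.span F (Set.range u) : Set (Fin (m + 1) → F)),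
      w ⬝ᵥ stdVec F (Fin.last m) = 1
  then h.choose else 0

theorem theta_seqA (v : IndexT F m) (ε : Fin m → Bool) (i : Fin m) :
    theta v (seqA ε i) = seqV v ε i := by
  unfold seqA seqV
  cases h : ε i <;> simp [theta]

theorem wVec_seqV (v : IndexT F m) (ε : Fin m → Bool) :
    (∀ i, wVec (seqV v ε) ⬝ᵥ seqV v ε i = 0) ∧
      wVec (seqV v ε) ⬝ᵥ stdVec F (Fin.last m) = 1 := by
  have hex : ∃ w ∈ perp (Submodule.span F (Set.range (seqV v ε)) : Set (Fin (m + 1) → F)),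
      w ⬝ᵥ stdVec F (Fin.last m) = 1 := by
    have hinj : Set.InjOn Vertex.pos
        ((insert Vertex.b (Finset.univ.image (seqA ε)) : Finset (Vertex m)) : Set (Vertex m)) := by
      intro x hx y hy hxy
      simp only [Finset.coe_insert, Finset.coe_image, Finset.coe_univ, Set.image_univ,
        Set.mem_insert_iff, Set.mem_range] at hx hy
      rcases hx with rfl | ⟨i, rfl⟩ <;> rcases hy with rfl | ⟨j, rfl⟩
      · rfl
      · exact ((Fin.castSucc_lt_last j).ne hxy.symm).elim
      · exact ((Fin.castSucc_lt_last i).ne hxy).elim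
      · rw [Fin.castSucc_injective m hxy]
    obtain ⟨w, -, hw⟩ := exists_dual v hinj (Fin.last m)
    refine ⟨w, ?_, ?_⟩
    · have hle : Submodule.span F (Set.range (seqV v ε))
          ≤ LinearMap.ker (dotProductBilin F F w) := by
        rw [Submodule.span_le]
        rintro _ ⟨i, rfl⟩
        have := hw (seqA ε i)
          (Finset.mem_insert_of_mem (Finset.mem_image_of_mem _ (Finset.mem_univ i)))
        rw [theta_seqA, if_neg] at this
        · exact this
        · exact (Fin.castSucc_lt_last i).ne
      exact fun s hs => hle hs
    · have := hw Vertex.b (Finset.mem_insert_self _ _)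
      rw [if_pos (show Vertex.b.pos = Fin.last m from rfl)] at this
      exact this
  have e : wVec (seqV v ε) = hex.choose := dif_pos hex
  rw [e]
  exact ⟨fun i => hex.choose_spec.1 _ (Submodule.subset_span ⟨i, rfl⟩), hex.choose_spec.2⟩

/-- The sign `χ(ε, π) = (-1)^{ε_1 + ⋯ + ε_{n-1}} sgn(π)`. -/
def chi (ε : Fin m → Bool) (π : Equiv.Perm (Fin m)) : ℤ :=
  (-1) ^ (Finset.univ.filter fun i => ε i = true).card * (Equiv.Perm.sign π : ℤ)

theorem mem_bottom_flag (v : IndexT F m) (x : Fin m → Vertex m)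
    (hx : Finset.univ.image x ∈ (coneComplex m).faces) (hinj : Function.Injective x)
    (w : Fin (m + 1) → F) (hw : ∀ i, w ⬝ᵥ theta v (x i) = 0) :
    w ∈ bottom ((fMap v).mapFace (flagSimplex x hx hinj).1).1 := by
  intro U hU
  obtain ⟨s, hs, rfl⟩ := Finset.mem_image.1 hU
  obtain ⟨i, -, rfl⟩ := Finset.mem_image.1 hs
  refine (mem_perpTheta v _ w).2 fun y hy => ?_
  obtain ⟨j, -, rfl⟩ := Finset.mem_image.1 hy
  exact hw j

theorem coeffAB_dot (v : IndexT F m) (j : Fin m) (ε : Fin m → Bool) (i : Fin m) :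
    (wVec (seqV v (Function.update ε j true)) - wVec (seqV v ε)) ⬝ᵥ theta v (seqAB ε j i) = 0 := by
  rw [sub_dotProduct, sub_eq_zero]
  by_cases h : i = j
  · have e : theta v (seqAB ε j i) = stdVec F (Fin.last m) := by simp [seqAB, h, theta]
    rw [e, (wVec_seqV v _).2, (wVec_seqV v _).2]
  · have e1 : theta v (seqAB ε j i) = seqV v ε i := by
      rw [← theta_seqA]; simp [seqAB, seqA, h]
    have e2 : seqV v ε i = seqV v (Function.update ε j true) i := by simp [seqV, h]
    rw [e1, (wVec_seqV v ε).1 i, e2, (wVec_seqV v _).1 i]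

/-- `w(v^ε)` as an element of `𝔥_v(S(π(a^ε)))`. -/
def coeffA (v : IndexT F m) (ε : Fin m → Bool) (π : Equiv.Perm (Fin m)) :
    (hSystem v).obj
      (flagSimplex (seqA ε ∘ π) (seqA_mem ε π) ((seqA_injective ε).comp π.injective)).1 :=
  ⟨wVec (seqV v ε), by
  exact mem_bottom_flag v _ _ _ _ fun i => by
      rw [Function.comp_apply, theta_seqA]; exact (wVec_seqV v ε).1 _⟩

/-- `w(v^{ε + e_j}) - w(v^ε)` as an element of `𝔥_v(S(π(a^{ε,j})))`, where `ε_j = 0`. -/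
def coeffAB (v : IndexT F m) (j : Fin m) (ε : Fin m → Bool) (π : Equiv.Perm (Fin m)) :
    (hSystem v).obj
      (flagSimplex (seqAB ε j ∘ π) (seqAB_mem ε j π)
        ((seqAB_injective ε j).comp π.injective)).1 :=
  ⟨wVec (seqV v (Function.update ε j true)) - wVec (seqV v ε), by
    exact mem_bottom_flag v _ _ _ _ fun i => coeffAB_dot v j ε _⟩

/-- The chain `c_v` on `sd(K)` of degree `n - 2`.  The simplices `S(π(a^ε))` and `S(π(a^{ε,j}))`
(with `ε_j = 0`) are pairwise distinct, so the summands are the values of `c_v` on them. -/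
def cChain (v : IndexT F m) : (hSystem v).Chain m :=
  (∑ ε : Fin m → Bool, ∑ π : Equiv.Perm (Fin m),
    chi ε π • (hSystem v).single
      (flagSimplex (seqA ε ∘ π) (seqA_mem ε π) ((seqA_injective ε).comp π.injective))
      (coeffA v ε π)) +
  ∑ j : Fin m, ∑ ε : Fin m → Bool with ε j = false, ∑ π : Equiv.Perm (Fin m),
    chi ε π • (hSystem v).single
      (flagSimplex (seqAB ε j ∘ π) (seqAB_mem ε j π) ((seqAB_injective ε j).comp π.injective))
      (coeffAB v j ε π)

end TwistedBuilding

end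

/-!
`∂ c_v = 0`: the faces of a flag `S(π(x))` other than the last one do not change when `π` is
composed with an adjacent transposition, so they cancel by the sign of `π`. In the last face the
largest simplex is dropped, so that it forgets the entry of `x` at the position `l = π(n-1)`.
Summing over `ε_l` turns `w(v^ε)` into its difference in the direction `l`, cancelled by the cone
simplices with `j = l`; the other cone simplices yield second differences in the directions `j`,
`l`, which are symmetric and cancel against the transposed permutation.

Independence: among the `c̃_u` only `c̃_v` has a nonzero coefficient at the chamber
`⟨v₁⟩^⊥ ⊃ ⟨v₁, v₂⟩^⊥ ⊃ ⋯ ⊃ ⟨v₁, …, v_{n-1}⟩^⊥`, and there it is `± w` with `w · e_n = 1`.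

Spanning: since there are no chains of degree `n - 1`, a homology class is a cycle `z`, and it
suffices that `z ≠ 0` forces a nonzero coefficient at one of these chambers. The cycle condition at
a codimension-one face says that the coefficients of the chambers around it sum to zero with signs,
so the support of `z` contains a second chamber there; at a face missing only the line it even
contains a third, because coefficients lie in their lines and distinct lines are independent.
Descending induction on the codimension then moves a chamber of the support to one of the required
form. The induction has to be carried out for an arbitrary sequence of linear forms `e_i, …, e_n`
without a common zero in the member of codimension `i`, because one step may replace the forms.
-/

noncomputable section

namespace TwistedBuilding

open scoped Classical DirectSum
open Module (Dual finrank)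

/-! ### Linear forms and bases -/

theorem exists_basis_of_injective_of_map_eq_single {R ι M : Type*} [Semiring R] [AddCommMonoid M]
    [Module R M] {φ : M →ₗ[R] ι →₀ R} (hφ : Function.Injective φ) {b : ι → M}
    (hb : ∀ i, φ (b i) = Finsupp.single i 1) :
    ∃ B : Module.Basis ι R M, ∀ i, B i = b i := by
  have hright : ∀ x, φ (Finsupp.linearCombination R b x) = x := fun x => by
    rw [Finsupp.apply_linearCombination, show φ ∘ b = fun i => Finsupp.single i 1 from funext hb,
      Finsupp.linearCombination_apply]
    simp
  refine ⟨.ofRepr (LinearEquiv.ofBijective φ ⟨hφ, fun x => ⟨_, hright x⟩⟩), fun i => ?_⟩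
  rw [Module.Basis.coe_ofRepr, LinearEquiv.symm_apply_eq]
  exact (hb i).symm

section LinearForms

variable {F V ι : Type*} [Field F] [AddCommGroup V] [Module F V] [FiniteDimensional F V]

theorem finrank_inf_ker_add_one {U : Submodule F V} {φ : Dual F V} {f : V} (hf : f ∈ U)
    (hφ : φ f ≠ 0) : finrank F ↥(U ⊓ LinearMap.ker φ) + 1 = finrank F U := by
  have hne : φ.domRestrict U ≠ 0 := fun h => hφ (LinearMap.congr_fun h ⟨f, hf⟩)
  have hmap : U ⊓ LinearMap.ker φ = (LinearMap.ker (φ.domRestrict U)).map U.subtype := by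
    ext u
    simp [and_comm]
  rw [← Module.Dual.finrank_ker_add_one_of_ne_zero hne, hmap,
    (Submodule.equivMapOfInjective U.subtype U.injective_subtype _).symm.finrank_eq]

theorem exists_mem_dual_vector {U : Submodule F V} {e : ι → Dual F V} {i : ι} {s : Set ι} [Finite s]
    (hsep : ∀ u ∈ U, e i u = 0 → (∀ j ∈ s, e j u = 0) → u = 0) (hcard : s.ncard < finrank F U) :
    ∃ f ∈ U, e i f = 1 ∧ ∀ j ∈ s, e j f = 0 := by
  let := Fintype.ofFinite s
  have hker : LinearMap.ker (LinearMap.pi fun j : s => (e j).domRestrict U) ≠ ⊥ :=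
    LinearMap.ker_ne_bot_of_finrank_lt (by
      rwa [Module.finrank_fintype_fun_eq_card, ← Nat.card_eq_fintype_card, Nat.card_coe_set_eq])
  obtain ⟨u, hu, hu0⟩ := Submodule.exists_mem_ne_zero_of_ne_bot hker
  have hs : ∀ j ∈ s, e j u = 0 := fun j hj => congrFun (LinearMap.mem_ker.1 hu) ⟨j, hj⟩
  have hi : e i u ≠ 0 := fun h => hu0 (Subtype.ext (hsep u u.2 h hs))
  exact ⟨(e i u)⁻¹ • u, U.smul_mem _ u.2, by simp [hi], fun j hj => by simp [hs j hj]⟩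

theorem eq_inf_ker_of_le {A U : Submodule F V} (hAU : A ≤ U) (hA : finrank F A + 1 = finrank F U)
    {φ : Dual F V} (hφ : A ≤ LinearMap.ker φ) {f : V} (hf : f ∈ U) (hφf : φ f ≠ 0) :
    A = U ⊓ LinearMap.ker φ :=
  Submodule.eq_of_le_of_finrank_eq (le_inf hAU hφ) (by
    have := finrank_inf_ker_add_one hf hφf
    omega)

theorem sup_span_singleton_eq {A U : Submodule F V} (hAU : A ≤ U)
    (hA : finrank F A + 1 = finrank F U) {f : V} (hf : f ∈ U) (hfA : f ∉ A) :
    A ⊔ Submodule.span F {f} = U := by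
  have hle : Submodule.span F {f} ≤ U := (Submodule.span_singleton_le_iff_mem _ _).2 hf
  have hlt : A < A ⊔ Submodule.span F {f} :=
    left_lt_sup.2 fun h => hfA ((Submodule.span_singleton_le_iff_mem _ _).1 h)
  exact Submodule.eq_of_le_of_finrank_le (sup_le hAU hle)
    (hA ▸ Submodule.finrank_lt_finrank_of_lt hlt)

theorem exists_eq_inf_ker {A U : Submodule F V} (hAU : A ≤ U)
    (hA : finrank F A + 1 = finrank F U) {e : ι → Dual F V} {i : ι} {s : Set ι} [Finite s]
    (hsep : ∀ u ∈ U, e i u = 0 → (∀ j ∈ s, e j u = 0) → u = 0) {f : V} (hfU : f ∈ U)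
    (hfA : f ∉ A) (hfi : e i f = 1) (hfs : ∀ j ∈ s, e j f = 0) :
    ∃ φ : Dual F V, φ - e i ∈ Submodule.span F (e '' s) ∧ A = U ⊓ LinearMap.ker φ := by
  obtain ⟨ψ, hψf, hψA⟩ := Submodule.exists_le_ker_of_notMem hfA
  have hmem : U.dualRestrict ((ψ f)⁻¹ • ψ - e i) ∈
      (Submodule.span F (e '' s)).map U.dualRestrict := by
    rw [Submodule.map_span, Set.image_image, Set.image_eq_range]
    refine mem_span_of_iInf_ker_le_ker fun u hu => ?_
    have hu' : ∀ j ∈ s, e j u = 0 := fun j hj => (Submodule.mem_iInf _).1 hu ⟨j, hj⟩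
    have huf : (u : V) - e i u • f = 0 :=
      hsep _ (U.sub_mem u.2 (U.smul_mem _ hfU)) (by simp [hfi])
        fun j hj => by simp [hu' j hj, hfs j hj]
    have huf' : (u : V) = e i u • f := sub_eq_zero.1 huf
    rw [LinearMap.mem_ker, Submodule.dualRestrict_apply, huf']
    simp [hfi, hψf]
  obtain ⟨χ, hχ, hχU⟩ := hmem
  have hφU : ∀ u ∈ U, (e i + χ) u = (ψ f)⁻¹ * ψ u := fun u hu => by
    have := LinearMap.congr_fun hχU ⟨u, hu⟩
    simp only [Submodule.dualRestrict_apply, LinearMap.sub_apply, LinearMap.smul_apply,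
      smul_eq_mul] at this
    rw [LinearMap.add_apply, this, add_sub_cancel]
  refine ⟨e i + χ, by simpa using hχ, eq_inf_ker_of_le hAU hA (fun a ha => ?_) hfU ?_⟩
  · rw [LinearMap.mem_ker, hφU a (hAU ha), LinearMap.mem_ker.1 (hψA ha), mul_zero]
  · rw [hφU f hfU, inv_mul_cancel₀ hψf]
    exact one_ne_zero

theorem exists_separating_of_apply_eq_one {U : Submodule F V} {φ : Dual F V} {f : V} (hφ : φ f = 1)
    {i : ι} {s : Set ι} [Finite s] (hi : i ∉ s)
    (hcard : finrank F ↥(U ⊓ LinearMap.ker φ) = s.ncard) :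
    ∃ e : ι → Dual F V, e i = φ ∧ (∀ j ∈ s, e j f = 0) ∧
      ∀ u ∈ U, e i u = 0 → (∀ j ∈ s, e j u = 0) → u = 0 := by
  let := Fintype.ofFinite s
  obtain ⟨b⟩ : Nonempty (Module.Basis s F ↥(U ⊓ LinearMap.ker φ)) :=
    ⟨(Module.finBasis F _).reindex (Fintype.equivOfCardEq (by
      rw [Fintype.card_fin, hcard, ← Nat.card_coe_set_eq, Nat.card_eq_fintype_card]))⟩
  choose g hg using fun j => LinearMap.exists_extend (b.coord j)
  have hg' : ∀ j u (hu : u ∈ U ⊓ LinearMap.ker φ), g j u = b.repr ⟨u, hu⟩ j :=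
    fun j u hu => LinearMap.congr_fun (hg j) ⟨u, hu⟩
  let p : V →ₗ[F] V := LinearMap.id - φ.smulRight f
  refine ⟨fun j => if hj : j ∈ s then g ⟨j, hj⟩ ∘ₗ p else φ, dif_neg hi, fun j hj => ?_,
    fun u hu hui hus => ?_⟩
  · simp [hj, p, hφ]
  · have hφu : φ u = 0 := by simpa [hi] using hui
    have hmem : u ∈ U ⊓ LinearMap.ker φ := ⟨hu, LinearMap.mem_ker.2 hφu⟩
    have hrepr : b.repr ⟨u, hmem⟩ = 0 := by
      ext j
      refine (hg' j u hmem).symm.trans ?_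
      simpa [p, hφu] using hus j j.2
    exact congrArg Subtype.val (b.repr.map_eq_zero_iff.1 hrepr)

end LinearForms

/-! ### Boundaries of twisted chains -/

namespace LocalSystem

variable {S R M : Type*} [Ring R] [AddCommGroup M] [Module R M] {X : OrderedCpx S}
  (A : LocalSystem R X) (φ : ∀ σ : X.faces, A.obj σ →ₗ[R] M)

/-- Twisted chains viewed as finitely supported functions on finite vertex sets, by means of maps
from the values of the local system to a fixed module. -/
def toFinsupp (k : ℕ) : A.Chain k →ₗ[R] Finset S →₀ M :=
  DirectSum.toModule R (X.Simplex k) _ fun σ => Finsupp.lsingle σ.1.1 ∘ₗ φ σ.1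

theorem toFinsupp_single {k : ℕ} (σ : X.Simplex k) (x : A.obj σ.1) :
    A.toFinsupp φ k (A.single σ x) = Finsupp.single σ.1.1 (φ σ.1 x) := by
  rw [toFinsupp, single, DirectSum.toModule_lof]
  rfl

theorem toFinsupp_apply {k : ℕ} (c : A.Chain k) (σ : X.Simplex k) :
    A.toFinsupp φ k c σ.1.1 = φ σ.1 (c σ) := by
  induction c using DirectSum.induction_on with
  | zero => simp
  | add a b ha hb => simp [ha, hb]
  | of τ x =>
    refine (DFunLike.congr_fun (A.toFinsupp_single φ τ x) σ.1.1).trans ?_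
    by_cases e : τ = σ
    · subst e
      simp
    · rw [Finsupp.single_eq_of_ne, DirectSum.of_eq_of_ne _ _ _ (Ne.symm e), map_zero]
      exact fun h => e (OrderedCpx.Simplex.ext (Subtype.ext h.symm))

theorem exists_simplex_of_toFinsupp_ne_zero {k : ℕ} {c : A.Chain k} {t : Finset S}
    (ht : A.toFinsupp φ k c t ≠ 0) : ∃ σ : X.Simplex k, σ.1.1 = t := by
  contrapose! ht
  induction c using DirectSum.induction_on with
  | zero => simp
  | add a b ha hb => simp [ha, hb]
  | of τ x =>
    refine (DFunLike.congr_fun (A.toFinsupp_single φ τ x) t).trans ?_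
    exact Finsupp.single_eq_of_ne (ht τ).symm

theorem toFinsupp_injective (hφ : ∀ σ, Function.Injective (φ σ)) (k : ℕ) :
    Function.Injective (A.toFinsupp φ k) := by
  intro c d h
  refine DFinsupp.ext fun σ => hφ _ ?_
  rw [← toFinsupp_apply, ← toFinsupp_apply, h]

/-- The sign of the vertex `s` in the finite vertex set `t`. -/
def vertexSign (X : OrderedCpx S) (t : Finset S) (s : S) : ℤ :=
  (-1) ^ (t.filter fun r => X.lt r s).card

theorem isUnit_vertexSign (t : Finset S) (s : S) : IsUnit (vertexSign X t s) :=
  (isUnit_one.neg).pow _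

variable {φ}

theorem toFinsupp_boundary_single
    (hres : ∀ {σ τ : X.faces} (h : σ.1 ⊆ τ.1) (x : A.obj τ), φ σ (A.res h x) = φ τ x)
    {k : ℕ} (σ : X.Simplex (k + 1)) (x : A.obj σ.1) :
    A.toFinsupp φ k (A.boundary k (A.single σ x)) =
      ∑ s ∈ σ.1.1, vertexSign X σ.1.1 s • Finsupp.single (σ.1.1.erase s) (φ σ.1 x) := by
  rw [boundary_single, map_sum]
  refine Eq.trans ?_ (Finset.sum_coe_sort σ.1.1 fun s =>
    vertexSign X σ.1.1 s • Finsupp.single (σ.1.1.erase s) (φ σ.1 x))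
  refine Finset.sum_congr rfl fun s _ => ?_
  rw [map_zsmul, toFinsupp_single]
  exact congrArg (fun y => σ.sgn s • Finsupp.single (σ.1.1.erase s.1) y)
    (hres (σ := (σ.face s).1) (Finset.erase_subset s.1 σ.1.1) x)

theorem toFinsupp_boundary
    (hres : ∀ {σ τ : X.faces} (h : σ.1 ⊆ τ.1) (x : A.obj τ), φ σ (A.res h x) = φ τ x)
    {k : ℕ} (c : A.Chain (k + 1)) :
    A.toFinsupp φ k (A.boundary k c) = (A.toFinsupp φ (k + 1) c).sum fun σ x =>
      ∑ s ∈ σ, vertexSign X σ s • Finsupp.single (σ.erase s) x := by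
  induction c using DirectSum.induction_on with
  | zero => simp
  | add a b ha hb =>
    rw [map_add, map_add, map_add, ha, hb, Finsupp.sum_add_index'] <;>
      simp [Finset.sum_add_distrib]
  | of τ x =>
    change A.toFinsupp φ k (A.boundary k (A.single τ x)) =
      Finsupp.sum (A.toFinsupp φ (k + 1) (A.single τ x)) _
    rw [toFinsupp_boundary_single A hres, toFinsupp_single, Finsupp.sum_single_index (by simp)]

theorem toFinsupp_boundary_apply
    (hres : ∀ {σ τ : X.faces} (h : σ.1 ⊆ τ.1) (x : A.obj τ), φ σ (A.res h x) = φ τ x)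
    {k : ℕ} (c : A.Chain (k + 1)) {t T : Finset S} (htT : Disjoint T t)
    (hT : ∀ s ∉ t, s ∉ T → A.toFinsupp φ (k + 1) c (insert s t) = 0) :
    A.toFinsupp φ k (A.boundary k c) t =
      ∑ s ∈ T, vertexSign X (insert s t) s • A.toFinsupp φ (k + 1) c (insert s t) := by
  rw [toFinsupp_boundary A hres, Finsupp.sum_apply, Finsupp.sum]
  simp only [Finsupp.finsetSum_apply, Finsupp.smul_apply, Finsupp.single_apply, smul_ite, smul_zero]
  rw [Finset.sum_sigma']
  symm
  refine Finset.sum_bij_ne_zero (fun s _ _ => ⟨insert s t, s⟩) ?_ ?_ ?_ ?_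
  · intro s _ hs
    simpa using right_ne_zero_of_smul hs
  · intro s _ _ s' _ _ h
    exact eq_of_heq (Sigma.mk.inj h).2
  · rintro ⟨σ, s⟩ hσ h
    obtain ⟨rfl, h0⟩ := ite_ne_right_iff.1 h
    obtain ⟨-, hs⟩ := Finset.mem_sigma.1 hσ
    have hins : insert s (σ.erase s) = σ := Finset.insert_erase hs
    refine ⟨s, ?_, by rwa [hins], by rw [hins]⟩
    by_contra hsT
    exact right_ne_zero_of_smul h0 (hins ▸ hT s (Finset.notMem_erase s σ) hsT)
  · intro s hs _
    rw [if_pos (Finset.erase_insert (Finset.disjoint_left.1 htT hs))]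

end LocalSystem

/-! ### The chains `c_v` are cycles -/

section Signs

variable {k : ℕ} {N M : Type*} [AddCommGroup N] [AddCommGroup M]

theorem chi_update (ε : Fin k → Bool) (π : Equiv.Perm (Fin k)) {l : Fin k} (h : ε l = false) :
    chi (Function.update ε l true) π = -chi ε π := by
  have e : (Finset.univ.filter fun i => Function.update ε l true i = true)
      = insert l (Finset.univ.filter fun i => ε i = true) := by
    ext i
    by_cases hi : i = l <;> simp [hi]
  rw [chi, chi, e, Finset.card_insert_of_notMem (by simp [h])]
  ring

theorem chi_mul_swap (ε : Fin k → Bool) (π : Equiv.Perm (Fin k)) {i j : Fin k} (h : i ≠ j) :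
    chi ε (π * Equiv.swap i j) = -chi ε π := by
  simp [chi, Equiv.Perm.sign_mul, Equiv.Perm.sign_swap h]

theorem chi_swap_mul (ε : Fin k → Bool) (π : Equiv.Perm (Fin k)) {i j : Fin k} (h : i ≠ j) :
    chi ε (Equiv.swap i j * π) = -chi ε π := by
  simp [chi, Equiv.Perm.sign_mul, Equiv.Perm.sign_swap h]

/-- The difference of a function on the cube `{0, 1}^k` in the direction `j`, meaningful at points
with `j`-th coordinate `0`. It makes the coefficients of `c_v` on the simplices `S(π(a^{ε,j}))`
differences of those on the simplices `S(π(a^ε))`. -/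
def cubeDiff (w : (Fin k → Bool) → M) (j : Fin k) (ε : Fin k → Bool) : M :=
  w (Function.update ε j true) - w ε

theorem cubeDiff_comm (w : (Fin k → Bool) → M) (i j : Fin k) :
    cubeDiff (cubeDiff w i) j = cubeDiff (cubeDiff w j) i := by
  rcases eq_or_ne i j with rfl | h
  · rfl
  · ext ε
    simp only [cubeDiff, Function.update_comm h]
    abel

theorem sum_filter_eq_sum_filter_add_update {l : Fin k} {P : (Fin k → Bool) → Prop}
    [DecidablePred P] (hP : ∀ ε, P (Function.update ε l true) ↔ P ε) (f : (Fin k → Bool) → N) :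
    ∑ ε with P ε, f ε = ∑ ε with P ε ∧ ε l = false, (f ε + f (Function.update ε l true)) := by
  rw [← Finset.sum_filter_add_sum_filter_not (Finset.univ.filter P) (fun ε => ε l = false),
    Finset.filter_filter, Finset.filter_filter, Finset.sum_add_distrib]
  congr 1
  refine Finset.sum_bij' (fun ε _ => Function.update ε l false)
    (fun ε _ => Function.update ε l true) ?_ ?_ ?_ ?_ ?_
  · intro ε h
    have := hP (Function.update ε l false)
    simp_all
  · intro ε h
    simp_all
  all_goals
    intro ε h
    simp only [Finset.mem_filter, Finset.mem_univ, true_and, Bool.not_eq_false] at h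
    simp [← h.2]

theorem sum_chi_smul_apply {l : Fin k} {P : (Fin k → Bool) → Prop} [DecidablePred P]
    (hP : ∀ ε, P (Function.update ε l true) ↔ P ε) {G : (Fin k → Bool) → M →+ N}
    (hG : ∀ ε, G (Function.update ε l true) = G ε) (π : Equiv.Perm (Fin k))
    (w : (Fin k → Bool) → M) :
    ∑ ε with P ε, chi ε π • G ε (w ε) =
      -∑ ε with P ε ∧ ε l = false, chi ε π • G ε (cubeDiff w l ε) := by
  rw [sum_filter_eq_sum_filter_add_update hP, ← Finset.sum_neg_distrib]
  refine Finset.sum_congr rfl fun ε hε => ?_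
  rw [chi_update _ _ (Finset.mem_filter.1 hε).2.2, hG, cubeDiff, map_sub, smul_sub, neg_smul]
  abel

end Signs

section LastFace

variable {k : ℕ} {N M : Type*} [AddCommGroup N] [AddCommGroup M]
  {E : (Fin (k + 1) → Vertex (k + 1)) → M →+ N}

theorem sum_chi_seqA (hE : ∀ x x', (∀ i, i ≠ Fin.last k → x i = x' i) → E x = E x')
    (w : (Fin (k + 1) → Bool) → M) (π : Equiv.Perm (Fin (k + 1))) :
    ∑ ε : Fin (k + 1) → Bool, chi ε π • E (seqA ε ∘ π) (w ε) =
      -∑ ε with ε (π (Fin.last k)) = false,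
        chi ε π • E (seqAB ε (π (Fin.last k)) ∘ π) (cubeDiff w (π (Fin.last k)) ε) := by
  have hAB : ∀ ε, E (seqA ε ∘ π) = E (seqAB ε (π (Fin.last k)) ∘ π) := fun ε =>
    hE _ _ fun i hi => by simp [seqA, seqAB, hi]
  simp only [hAB]
  simpa only [Finset.filter_true, true_and] using
    sum_chi_smul_apply (l := π (Fin.last k)) (P := fun _ => True) (fun _ => Iff.rfl)
      (G := fun ε => E (seqAB ε (π (Fin.last k)) ∘ π))
      (fun ε => hE _ _ fun i hi => by simp [seqAB, hi]) π w

theorem sum_chi_seqAB (hE : ∀ x x', (∀ i, i ≠ Fin.last k → x i = x' i) → E x = E x')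
    (w : (Fin (k + 1) → Bool) → M) (π : Equiv.Perm (Fin (k + 1))) {j : Fin (k + 1)}
    (hj : j ≠ π (Fin.last k)) :
    ∑ ε with ε j = false, chi ε π • E (seqAB ε j ∘ π) (cubeDiff w j ε) =
      -∑ ε with ε j = false ∧ ε (π (Fin.last k)) = false,
        chi ε π • E (seqAB ε j ∘ π) (cubeDiff (cubeDiff w j) (π (Fin.last k)) ε) :=
  sum_chi_smul_apply (P := fun ε => ε j = false) (G := fun ε => E (seqAB ε j ∘ π))
    (fun ε => by simp [hj]) (fun ε => hE _ _ fun i hi => by simp [seqAB, hi]) π (cubeDiff w j)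

theorem sum_chi_seqAB_pairs (hE : ∀ x x', (∀ i, i ≠ Fin.last k → x i = x' i) → E x = E x')
    (w : (Fin (k + 1) → Bool) → M) :
    ∑ P : Equiv.Perm (Fin (k + 1)) × Fin (k + 1) with P.2 ≠ P.1 (Fin.last k),
      ∑ ε with ε P.2 = false ∧ ε (P.1 (Fin.last k)) = false, chi ε P.1 •
        E (seqAB ε P.2 ∘ P.1) (cubeDiff (cubeDiff w P.2) (P.1 (Fin.last k)) ε) = 0 := by
  refine Finset.sum_involution
    (fun P _ => (Equiv.swap P.2 (P.1 (Fin.last k)) * P.1, P.1 (Fin.last k))) ?_ ?_ ?_ ?_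
  · rintro ⟨π, j⟩ h
    have hj : j ≠ π (Fin.last k) := (Finset.mem_filter.1 h).2
    have hlast : (Equiv.swap j (π (Fin.last k)) * π) (Fin.last k) = j := by simp
    have hface : ∀ ε, E (seqAB ε (π (Fin.last k)) ∘ ⇑(Equiv.swap j (π (Fin.last k)) * π)) =
        E (seqAB ε j ∘ π) := fun ε => hE _ _ fun i hi => by
      have hi' : π i ≠ π (Fin.last k) := π.injective.ne hi
      by_cases hij : π i = j
      · simp [seqAB, hij]
      · simp [seqAB, hij, Equiv.swap_apply_of_ne_of_ne hij hi', hi']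
    simp only [hlast, hface, chi_swap_mul _ _ hj, cubeDiff_comm w (π (Fin.last k)), neg_smul,
      Finset.sum_neg_distrib, and_comm (a := _ = false) (b := _ = false)]
    exact add_neg_cancel _
  · rintro ⟨π, j⟩ h _ he
    exact (Finset.mem_filter.1 h).2 (congrArg Prod.snd he).symm
  · rintro ⟨π, j⟩ h
    simpa using (Finset.mem_filter.1 h).2.symm
  · rintro ⟨π, j⟩ _
    ext1
    · simp [Equiv.swap_comm, ← mul_assoc]
    · simp

theorem sum_last_face_eq_zero (hE : ∀ x x', (∀ i, i ≠ Fin.last k → x i = x' i) → E x = E x')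
    (w : (Fin (k + 1) → Bool) → M) :
    ∑ π : Equiv.Perm (Fin (k + 1)), ∑ ε : Fin (k + 1) → Bool, chi ε π • E (seqA ε ∘ π) (w ε) +
      ∑ π : Equiv.Perm (Fin (k + 1)), ∑ j : Fin (k + 1), ∑ ε with ε j = false,
        chi ε π • E (seqAB ε j ∘ π) (cubeDiff w j ε) = 0 := by
  rw [← Finset.sum_add_distrib, ← neg_zero (G := N), ← sum_chi_seqAB_pairs hE w,
    Finset.sum_filter, Fintype.sum_prod_type, ← Finset.sum_neg_distrib]
  refine Finset.sum_congr rfl fun π _ => ?_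
  rw [sum_chi_seqA hE, ← Finset.sum_erase_add _ _ (Finset.mem_univ (π (Fin.last k))),
    neg_add_cancel_comm_assoc]
  rw [← Finset.sum_filter, ← Finset.filter_ne', ← Finset.sum_neg_distrib]
  exact Finset.sum_congr rfl fun j hj => sum_chi_seqAB hE w π (Finset.mem_filter.1 hj).2

end LastFace

/-- The prefixes of the sequence `x`, with the `i`-th one omitted: the face of `S(x)` opposite to
the vertex `{x_1, …, x_i}`. -/
def prefixFace {S : Type*} {k : ℕ} (x : Fin k → S) (i : Fin k) : Finset (Finset S) :=
  (Finset.univ.erase i).image fun r => (Finset.Iic r).image x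

theorem prefixFace_last_congr {S : Type*} {k : ℕ} {x y : Fin (k + 1) → S}
    (h : ∀ i, i ≠ Fin.last k → x i = y i) :
    prefixFace x (Fin.last k) = prefixFace y (Fin.last k) := by
  refine Finset.image_congr fun r hr => Finset.image_congr fun s hs => h s ?_
  have hr' : r ≠ Fin.last k := Finset.ne_of_mem_erase (Finset.mem_coe.1 hr)
  exact ((Finset.mem_Iic.1 hs).trans_lt (Fin.lt_last_iff_ne_last.2 hr')).ne

theorem prefixFace_comp_swap {S : Type*} {k : ℕ} (x : Fin (k + 1) → S) (i : Fin k) :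
    prefixFace (x ∘ Equiv.swap i.castSucc i.succ) i.castSucc = prefixFace x i.castSucc := by
  refine Finset.image_congr fun r hr => ?_
  have hr' : r ≠ i.castSucc := Finset.ne_of_mem_erase (Finset.mem_coe.1 hr)
  have hmaps : ∀ s ≤ r, Equiv.swap i.castSucc i.succ s ≤ r := by
    intro s hs
    rw [Equiv.swap_apply_def]
    split_ifs with h1 h2
    · exact Fin.castSucc_lt_iff_succ_le.1 (lt_of_le_of_ne (h1 ▸ hs) hr'.symm)
    · exact (Fin.castSucc_lt_succ (i := i)).le.trans (h2 ▸ hs)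
    · exact hs
  ext y
  simp only [Finset.mem_image, Finset.mem_Iic, Function.comp_apply]
  constructor
  · rintro ⟨s, hs, rfl⟩
    exact ⟨_, hmaps s hs, rfl⟩
  · rintro ⟨s, hs, rfl⟩
    exact ⟨_, hmaps s hs, by rw [Equiv.swap_apply_self]⟩

theorem sum_chi_prefixFace_castSucc {S M : Type*} [AddCommGroup M] {k : ℕ} (x : Fin (k + 1) → S)
    (ε : Fin (k + 1) → Bool) (i : Fin k) (y : M) :
    ∑ π : Equiv.Perm (Fin (k + 1)),
      chi ε π • Finsupp.single (prefixFace (x ∘ π) i.castSucc) y = 0 := by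
  have hne : i.castSucc ≠ i.succ := (Fin.castSucc_lt_succ (i := i)).ne
  refine Finset.sum_involution (fun π _ => π * Equiv.swap i.castSucc i.succ) ?_ ?_ ?_ ?_
  · intro π _
    rw [chi_mul_swap _ _ hne, Equiv.Perm.coe_mul, ← Function.comp_assoc, prefixFace_comp_swap,
      neg_smul, add_neg_cancel]
  · intro π _ _ h
    rw [mul_eq_left, Equiv.swap_eq_one_iff] at h
    exact hne h
  · intro π _
    exact Finset.mem_univ _
  · intro π _
    rw [mul_assoc, Equiv.swap_mul_self, mul_one]

theorem sum_chi_prefixFace {S M : Type*} [AddCommGroup M] {k : ℕ} (x : Fin (k + 1) → S)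
    (ε : Fin (k + 1) → Bool) (s : Fin (k + 1) → ℤ) (y : M) :
    ∑ π : Equiv.Perm (Fin (k + 1)), chi ε π •
        ∑ i, s i • Finsupp.single (prefixFace (x ∘ π) i) y =
      ∑ π : Equiv.Perm (Fin (k + 1)), chi ε π • s (Fin.last k) •
        Finsupp.single (prefixFace (x ∘ π) (Fin.last k)) y := by
  simp only [Fin.sum_univ_castSucc, smul_add, Finset.sum_add_distrib, Finset.smul_sum]
  rw [Finset.sum_comm, add_eq_right]
  refine Finset.sum_eq_zero fun i _ => ?_
  simp only [smul_comm _ (s i.castSucc)]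
  rw [← Finset.smul_sum, sum_chi_prefixFace_castSucc, smul_zero]

theorem sum_flag_faces_eq_zero {M : Type*} [AddCommGroup M] {k : ℕ}
    (w : (Fin (k + 1) → Bool) → M) (s : Fin (k + 1) → ℤ) :
    ∑ ε : Fin (k + 1) → Bool, ∑ π : Equiv.Perm (Fin (k + 1)), chi ε π •
        ∑ i, s i • Finsupp.single (prefixFace (seqA ε ∘ π) i) (w ε) +
      ∑ j : Fin (k + 1), ∑ ε with ε j = false, ∑ π : Equiv.Perm (Fin (k + 1)), chi ε π •
        ∑ i, s i • Finsupp.single (prefixFace (seqAB ε j ∘ π) i) (cubeDiff w j ε) = 0 := by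
  simp only [sum_chi_prefixFace]
  have h := sum_last_face_eq_zero
    (E := fun x => s (Fin.last k) • Finsupp.singleAddHom (M := M) (prefixFace x (Fin.last k)))
    (fun x x' hx => by rw [prefixFace_last_congr hx]) w
  rw [Finset.sum_comm, ← h]
  congr 1
  rw [Finset.sum_comm]
  refine Finset.sum_congr rfl fun j _ => ?_
  rw [Finset.sum_comm]
  rfl

theorem vertexSign_prefixVertex {S : Type*} {K : SimplicialCpx S} {k : ℕ} (x : Fin k → S)
    (hx : Finset.univ.image x ∈ K.faces) (hinj : Function.Injective x) (i : Fin k) :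
    LocalSystem.vertexSign (sd K) (Finset.univ.image (prefixVertex x hx)) (prefixVertex x hx i)
      = (-1) ^ (k - 1 - i : ℕ) := by
  have hlt : ∀ a b, (sd K).lt (prefixVertex x hx a) (prefixVertex x hx b) ↔ b < a := by
    intro a b
    change (Finset.Iic b).image x ⊂ (Finset.Iic a).image x ↔ b < a
    rw [Finset.image_ssubset_image hinj, Finset.Iic_ssubset_Iic]
  have hlower : (Finset.univ.image (prefixVertex x hx)).filter
      (fun r => (sd K).lt r (prefixVertex x hx i)) = (Finset.Ioi i).image (prefixVertex x hx) := by
    rw [Finset.filter_image]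
    congr 1
    ext a
    simp [hlt]
  rw [LocalSystem.vertexSign, hlower,
    Finset.card_image_of_injective _ (prefixVertex_injective x hx hinj), Fin.card_Ioi]

theorem mapDomain_toFinsupp_boundary_flagSimplex {S R M : Type*} [Ring R] [AddCommGroup M]
    [Module R M] {K : SimplicialCpx S} (A : LocalSystem R (sd K))
    {φ : ∀ σ : (sd K).faces, A.obj σ →ₗ[R] M}
    (hres : ∀ {σ τ : (sd K).faces} (h : σ.1 ⊆ τ.1) (x : A.obj τ), φ σ (A.res h x) = φ τ x)
    {k : ℕ} (x : Fin (k + 1) → S) (hx : Finset.univ.image x ∈ K.faces)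
    (hinj : Function.Injective x) (y : A.obj (flagSimplex x hx hinj).1) :
    Finsupp.mapDomain (Finset.image SdVertex.val)
        (A.toFinsupp φ k (A.boundary k (A.single (flagSimplex x hx hinj) y))) =
      ∑ i : Fin (k + 1), ((-1) ^ (k - i : ℕ) : ℤ) • Finsupp.single (prefixFace x i) (φ _ y) := by
  have hpi := prefixVertex_injective x hx hinj
  rw [A.toFinsupp_boundary_single hres]
  change Finsupp.mapDomain _ (∑ s ∈ Finset.univ.image (prefixVertex x hx), _) = _
  rw [Finset.sum_image hpi.injOn, Finsupp.mapDomain_finsetSum]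
  refine Finset.sum_congr rfl fun i _ => ?_
  have hsign : LocalSystem.vertexSign (sd K) (flagSimplex x hx hinj).1.1 (prefixVertex x hx i) =
      (-1) ^ (k - i : ℕ) := vertexSign_prefixVertex x hx hinj i
  rw [hsign, Finsupp.mapDomain_smul, Finsupp.mapDomain_single]
  congr 2
  change ((Finset.univ.image (prefixVertex x hx)).erase (prefixVertex x hx i)).image _ = _
  rw [← Finset.image_erase hpi, Finset.image_image]
  rfl

variable {F : Type*} [Field F] {m : ℕ}

/-- The inclusion of the values of `𝔤` into `V`. -/
def tautIncl (σ : (building F m).faces) : (taut F m).obj σ →ₗ[F] (Fin (m + 1) → F) :=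
  (bottom σ.1).subtype

theorem tautIncl_injective (σ : (building F m).faces) : Function.Injective (tautIncl σ) :=
  Subtype.val_injective

theorem tautIncl_res {σ τ : (building F m).faces} (h : σ.1 ⊆ τ.1) (x : (taut F m).obj τ) :
    tautIncl σ ((taut F m).res h x) = tautIncl τ x :=
  coe_bottomIncl h x

theorem cChain_mem_cycles (v : IndexT F m) : cChain v ∈ (hSystem v).cycles m := by
  cases m with
  | zero => exact Submodule.mem_top
  | succ k =>
    change (hSystem v).boundary k (cChain v) = 0
    have hval : Function.Injective (SdVertex.val (K := coneComplex (k + 1))) :=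
      fun _ _ => SdVertex.ext
    apply (hSystem v).toFinsupp_injective (fun σ => tautIncl ((fMap v).mapFace σ))
      (fun σ => tautIncl_injective _) k
    apply Finsupp.mapDomain_injective (Finset.image_injective hval)
    have hflag := mapDomain_toFinsupp_boundary_flagSimplex (hSystem v)
      (φ := fun σ => tautIncl ((fMap v).mapFace σ))
      (fun h x => tautIncl_res (Finset.image_subset_image h) x) (k := k)
    rw [map_zero, Finsupp.mapDomain_zero, cChain]
    simp only [map_add, map_sum, map_zsmul, Finsupp.mapDomain_add, Finsupp.mapDomain_finsetSum,
      Finsupp.mapDomain_smul, hflag]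
    exact sum_flag_faces_eq_zero (fun ε => wVec (seqV v ε)) fun i => (-1) ^ (k - i : ℕ)

/-! ### Complete flags -/

theorem finrank_properSubspace_mem_Icc (B : ProperSubspace F m) :
    finrank F B.val ∈ Finset.Icc 1 m := by
  have hlt := Submodule.finrank_lt B.property.2
  rw [Module.finrank_fin_fun] at hlt
  exact Finset.mem_Icc.2 ⟨Submodule.one_le_finrank_iff.2 B.property.1, Nat.le_of_lt_succ hlt⟩

theorem val_le_of_finrank_le {σ : Finset (ProperSubspace F m)} (hσ : σ ∈ (building F m).faces)
    {A B : ProperSubspace F m} (hA : A ∈ σ) (hB : B ∈ σ)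
    (h : finrank F A.val ≤ finrank F B.val) : A.val ≤ B.val := by
  rcases hσ.total hA hB with hAB | hBA
  · exact hAB
  · exact (Submodule.eq_of_le_of_finrank_le (show B.val ≤ A.val from hBA) h).ge

theorem injOn_finrank {σ : Finset (ProperSubspace F m)} (hσ : σ ∈ (building F m).faces) :
    Set.InjOn (fun B : ProperSubspace F m => finrank F B.val) σ := fun _ hA _ hB h =>
  ProperSubspace.ext ((val_le_of_finrank_le hσ hA hB h.le).antisymm
    (val_le_of_finrank_le hσ hB hA h.ge))

theorem card_le_of_mem_faces {σ : Finset (ProperSubspace F m)} (hσ : σ ∈ (building F m).faces) :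
    σ.card ≤ m := by
  simpa using Finset.card_le_card_of_injOn _ (fun B _ => finrank_properSubspace_mem_Icc B)
    (injOn_finrank hσ)

variable (F m) in
/-- The complete flags `V = L_0 ⊃ L_1 ⊃ ⋯ ⊃ L_m` of subspaces, indexed by codimension. -/
@[ext]
structure CompleteFlag where
  space : Fin (m + 1) → Submodule F (Fin (m + 1) → F)
  antitone : Antitone space
  finrank_add : ∀ i, finrank F (space i) + i = m + 1

namespace CompleteFlag

theorem space_zero (L : CompleteFlag F m) : L.space 0 = ⊤ :=
  Submodule.eq_top_of_finrank_eq (by simpa using L.finrank_add 0)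

theorem finrank_succ_add_one (L : CompleteFlag F m) (i : Fin m) :
    finrank F (L.space i.succ) + 1 = finrank F (L.space i.castSucc) := by
  have h1 := L.finrank_add i.succ
  have h2 := L.finrank_add i.castSucc
  simp only [Fin.val_succ, Fin.val_castSucc] at h1 h2
  omega

theorem space_succ_le (L : CompleteFlag F m) (i : Fin m) : L.space i.succ ≤ L.space i.castSucc :=
  L.antitone Fin.castSucc_lt_succ.le

theorem eq_of_space_eq {L L' : CompleteFlag F m} {i j : Fin (m + 1)}
    (h : L.space i = L'.space j) : i = j := by
  have h1 := L.finrank_add i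
  have h2 := L'.finrank_add j
  rw [h] at h1
  omega

theorem space_eq_span_singleton (L : CompleteFlag F m) {i : Fin (m + 1)} (hi : i = Fin.last m)
    {f : Fin (m + 1) → F} (hf : f ∈ L.space i) (hf0 : f ≠ 0) :
    L.space i = Submodule.span F {f} := by
  refine (Submodule.eq_of_le_of_finrank_eq ((Submodule.span_singleton_le_iff_mem _ _).2 hf) ?_).symm
  have h := L.finrank_add i
  rw [hi, Fin.val_last] at h
  rw [finrank_span_singleton hf0, hi]
  omega

/-- The proper member of codimension `i + 1`, a vertex of the building. -/
def member (L : CompleteFlag F m) (i : Fin m) : ProperSubspace F m where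
  val := L.space i.succ
  property := by
    have h := L.finrank_add i.succ
    rw [Fin.val_succ] at h
    constructor
    · intro hbot
      rw [hbot, finrank_bot] at h
      omega
    · intro htop
      rw [htop, finrank_top, Module.finrank_fin_fun] at h
      omega

theorem member_injective (L : CompleteFlag F m) : Function.Injective L.member := fun _ _ h =>
  Fin.succ_injective m (eq_of_space_eq (congrArg ProperSubspace.val h))

/-- The maximal simplex of the building given by a complete flag. -/
def chamber (L : CompleteFlag F m) : (building F m).Simplex m where
  val := ⟨Finset.univ.image L.member, by
    rw [building, orderComplex, Set.mem_ofPred_eq, Finset.coe_image, Finset.coe_univ,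
      Set.image_univ]
    exact (show Antitone L.member from fun i j hij =>
      L.antitone (Fin.succ_le_succ_iff.2 hij)).isChain_range⟩
  card_eq := by
    rw [Finset.card_image_of_injective _ L.member_injective, Finset.card_univ, Fintype.card_fin]

theorem member_mem_chamber (L : CompleteFlag F m) (i : Fin m) : L.member i ∈ L.chamber.1.1 :=
  Finset.mem_image_of_mem _ (Finset.mem_univ i)

theorem mem_chamber {L : CompleteFlag F m} {B : ProperSubspace F m} :
    B ∈ L.chamber.1.1 ↔ ∃ i, L.member i = B := by
  simp [chamber]

theorem exists_chamber_eq (σ : (building F m).Simplex m) :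
    ∃ L : CompleteFlag F m, L.chamber = σ := by
  have himage : σ.1.1.image (fun B => finrank F B.val) = Finset.Icc 1 m :=
    Finset.eq_of_subset_of_card_le
      (Finset.image_subset_iff.2 fun B _ => finrank_properSubspace_mem_Icc B) (by
        rw [Finset.card_image_of_injOn (injOn_finrank σ.1.2), σ.2, Nat.card_Icc,
          Nat.add_sub_cancel])
  have hexists : ∀ i : Fin m, ∃ B ∈ σ.1.1, finrank F B.val = m - i := fun i =>
    Finset.mem_image.1 (himage ▸ Finset.mem_Icc.2 (by omega))
  choose B hBσ hB using hexists
  let space : Fin (m + 1) → Submodule F (Fin (m + 1) → F) := Fin.cons ⊤ fun i => (B i).val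
  let L : CompleteFlag F m :=
    { space := space
      antitone := fun i j hij => by
        cases i using Fin.cases with
        | zero => exact le_top
        | succ i =>
          cases j using Fin.cases with
          | zero => exact absurd hij (not_le.2 i.succ_pos)
          | succ j =>
            refine val_le_of_finrank_le σ.1.2 (hBσ j) (hBσ i) ?_
            rw [hB, hB]
            exact Nat.sub_le_sub_left (Fin.succ_le_succ_iff.1 hij) m
      finrank_add := fun i => by
        cases i using Fin.cases with
        | zero => exact (finrank_top F _).trans (Module.finrank_fin_fun F)
        | succ i =>
          change finrank F (B i).val + (i + 1) = m + 1
          rw [hB]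
          omega }
  refine ⟨L, OrderedCpx.Simplex.ext (Subtype.ext (Finset.eq_of_subset_of_card_le ?_ ?_))⟩
  · intro A hA
    obtain ⟨i, rfl⟩ := mem_chamber.1 hA
    exact hBσ i
  · rw [L.chamber.2, σ.2]

/-- The flags `L` and `L'` agree away from codimension `i + 1`. -/
def IsAdjacent (i : Fin m) (L L' : CompleteFlag F m) : Prop :=
  ∀ j ≠ i.succ, L'.space j = L.space j

theorem IsAdjacent.eq {i : Fin m} {L L' : CompleteFlag F m} (h : IsAdjacent i L L')
    (hi : L'.space i.succ = L.space i.succ) : L' = L := by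
  ext1
  funext j
  by_cases hj : j = i.succ
  · rw [hj, hi]
  · exact h j hj

theorem IsAdjacent.insert_erase_chamber {i : Fin m} {L L' : CompleteFlag F m}
    (h : IsAdjacent i L L') :
    insert (L'.member i) (L.chamber.1.1.erase (L.member i)) = L'.chamber.1.1 := by
  have hmem : ∀ j ≠ i, L'.member j = L.member j := fun j hj =>
    ProperSubspace.ext (h _ ((Fin.succ_injective m).ne hj))
  rw [chamber, chamber, ← Finset.image_erase L.member_injective,
    ← Finset.image_congr fun j hj => hmem j (Finset.ne_of_mem_erase hj), ← Finset.image_insert,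
    Finset.insert_erase (Finset.mem_univ i)]

theorem isAdjacent_of_erase_subset {i : Fin m} {L L' : CompleteFlag F m}
    (h : L.chamber.1.1.erase (L.member i) ⊆ L'.chamber.1.1) : IsAdjacent i L L' := by
  intro j hj
  cases j using Fin.cases with
  | zero => rw [space_zero, space_zero]
  | succ j =>
    have hji : L.member j ≠ L.member i := fun e => hj (congrArg Fin.succ (L.member_injective e))
    obtain ⟨l, hl⟩ := mem_chamber.1 (h (Finset.mem_erase.2 ⟨hji, L.member_mem_chamber j⟩))
    have hl' : L'.space l.succ = L.space j.succ := congrArg ProperSubspace.val hl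
    exact Fin.succ_injective m (eq_of_space_eq hl') ▸ hl'

end CompleteFlag

theorem boundary_top_eq_zero (d : (taut F m).Chain (m + 1)) : (taut F m).boundary m d = 0 := by
  have : IsEmpty ((building F m).Simplex (m + 1)) := ⟨fun σ => by
    have := card_le_of_mem_faces σ.1.2
    rw [σ.2] at this
    omega⟩
  rw [Subsingleton.elim d 0, map_zero]

/-- The coefficient of a chain at a complete flag, as a vector of `V`. -/
def flagCoeff (z : (taut F m).Chain m) (L : CompleteFlag F m) : Fin (m + 1) → F :=
  (taut F m).toFinsupp tautIncl m z L.chamber.1.1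

theorem flagCoeff_mem (z : (taut F m).Chain m) (L : CompleteFlag F m) (i : Fin m) :
    flagCoeff z L ∈ L.space i.succ := by
  rw [flagCoeff, LocalSystem.toFinsupp_apply]
  exact (z L.chamber).2 _ (L.member_mem_chamber i)

theorem eq_zero_of_flagCoeff_eq_zero {z : (taut F m).Chain m} (h : ∀ L, flagCoeff z L = 0) :
    z = 0 := by
  refine (taut F m).toFinsupp_injective tautIncl tautIncl_injective m ?_
  ext1 t
  rw [map_zero, Finsupp.zero_apply]
  by_contra ht
  obtain ⟨σ, rfl⟩ := LocalSystem.exists_simplex_of_toFinsupp_ne_zero _ _ ht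
  obtain ⟨L, rfl⟩ := CompleteFlag.exists_chamber_eq σ
  exact ht (h L)

theorem exists_adjacent_of_toFinsupp_ne_zero {z : (taut F m).Chain m} {L : CompleteFlag F m}
    {i : Fin m} {s : ProperSubspace F m} (hs : s ∉ L.chamber.1.1.erase (L.member i))
    (hne : (taut F m).toFinsupp tautIncl m z (insert s (L.chamber.1.1.erase (L.member i))) ≠ 0) :
    ∃ L', L.IsAdjacent i L' ∧ L'.member i = s ∧
      L'.chamber.1.1 = insert s (L.chamber.1.1.erase (L.member i)) := by
  obtain ⟨σ, hσ⟩ := LocalSystem.exists_simplex_of_toFinsupp_ne_zero _ _ hne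
  obtain ⟨L', rfl⟩ := CompleteFlag.exists_chamber_eq σ
  have hadj : L.IsAdjacent i L' :=
    CompleteFlag.isAdjacent_of_erase_subset (hσ ▸ Finset.subset_insert s _)
  have hmem : s ∈ insert (L'.member i) (L.chamber.1.1.erase (L.member i)) := by
    rw [hadj.insert_erase_chamber, hσ]
    exact Finset.mem_insert_self s _
  exact ⟨L', hadj, ((Finset.mem_insert.1 hmem).resolve_right hs).symm, hσ⟩

section Cycles

variable {z : (taut F m).Chain m} (hz : z ∈ (taut F m).cycles m)
include hz

theorem sum_flagCoeff_adjacent {L : CompleteFlag F m} {i : Fin m} {T : Finset (CompleteFlag F m)}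
    (hadj : ∀ L' ∈ T, L.IsAdjacent i L')
    (hT : ∀ L', L.IsAdjacent i L' → L' ∉ T → flagCoeff z L' = 0) :
    ∑ L' ∈ T, LocalSystem.vertexSign (building F m) L'.chamber.1.1 (L'.member i) •
      flagCoeff z L' = 0 := by
  obtain _ | k := m
  · exact i.elim0
  let t := L.chamber.1.1.erase (L.member i)
  have hinsert : ∀ L' ∈ T, insert (L'.member i) t = L'.chamber.1.1 :=
    fun L' hL' => (hadj L' hL').insert_erase_chamber
  have hinj : Set.InjOn (fun L' : CompleteFlag F (k + 1) => L'.member i) T := fun L₁ h₁ L₂ h₂ h =>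
    CompleteFlag.IsAdjacent.eq (i := i)
      (fun j hj => (hadj L₁ h₁ j hj).trans (hadj L₂ h₂ j hj).symm)
      (congrArg ProperSubspace.val h)
  have hdisj : Disjoint (T.image fun L' => L'.member i) t := by
    rw [Finset.disjoint_left]
    intro B hB hBt
    obtain ⟨L', _, rfl⟩ := Finset.mem_image.1 hB
    obtain ⟨j, hj⟩ := CompleteFlag.mem_chamber.1 (Finset.mem_of_mem_erase hBt)
    have hji : j = i := Fin.succ_injective _
      (CompleteFlag.eq_of_space_eq (congrArg ProperSubspace.val hj))
    exact Finset.ne_of_mem_erase hBt (hji ▸ hj.symm)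
  have hvanish : ∀ s ∉ t, s ∉ T.image (fun L' => L'.member i) →
      (taut F (k + 1)).toFinsupp tautIncl (k + 1) z (insert s t) = 0 := by
    intro s hs hsT
    by_contra hne
    obtain ⟨L', hL', rfl, hchamber⟩ := exists_adjacent_of_toFinsupp_ne_zero hs hne
    exact hne (hchamber ▸ hT L' hL' fun hmem => hsT (Finset.mem_image_of_mem _ hmem))
  have hsum := LocalSystem.toFinsupp_boundary_apply (taut F (k + 1)) tautIncl_res z hdisj hvanish
  rw [show (taut F (k + 1)).boundary k z = 0 from hz, map_zero, Finsupp.zero_apply,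
    Finset.sum_image hinj] at hsum
  rw [hsum]
  exact Finset.sum_congr rfl fun L' hL' => by rw [flagCoeff, hinsert L' hL']

theorem exists_adjacent_flagCoeff_ne_zero {L : CompleteFlag F m} (hL : flagCoeff z L ≠ 0)
    (i : Fin m) :
    ∃ L', L.IsAdjacent i L' ∧ L'.space i.succ ≠ L.space i.succ ∧ flagCoeff z L' ≠ 0 := by
  by_contra! hcon
  have hsum := sum_flagCoeff_adjacent hz (L := L) (i := i) (T := {L})
    (by simp [CompleteFlag.IsAdjacent])
    fun L' hadj hL' => hcon L' hadj fun h => hL' (Finset.mem_singleton.2 (hadj.eq h))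
  rw [Finset.sum_singleton] at hsum
  exact hL ((LocalSystem.isUnit_vertexSign _ _).smul_eq_zero.1 hsum)

/-- Vectors on two distinct lines cannot cancel in the boundary, so a third line is involved. -/
theorem exists_adjacent_flagCoeff_ne_zero_of_last {L : CompleteFlag F m} (hL : flagCoeff z L ≠ 0)
    {i : Fin m} (hi : i.succ = Fin.last m) {A : Submodule F (Fin (m + 1) → F)} :
    ∃ L', L.IsAdjacent i L' ∧ L'.space i.succ ≠ L.space i.succ ∧ L'.space i.succ ≠ A ∧
      flagCoeff z L' ≠ 0 := by
  obtain ⟨L₁, hadj, hne, hL₁⟩ := exists_adjacent_flagCoeff_ne_zero hz hL i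
  by_cases hA : L₁.space i.succ = A
  swap
  · exact ⟨L₁, hadj, hne, hA, hL₁⟩
  by_contra! hcon
  have hneL : L ≠ L₁ := fun h => hne (h ▸ rfl)
  have hsum := sum_flagCoeff_adjacent hz (L := L) (i := i) (T := {L, L₁})
    (by simpa [CompleteFlag.IsAdjacent] using hadj) fun L' hadj' hL' => by
      simp only [Finset.mem_insert, Finset.mem_singleton, not_or] at hL'
      refine hcon L' hadj' (fun h => hL'.1 (hadj'.eq h)) fun h => hL'.2 ?_
      exact CompleteFlag.IsAdjacent.eq (fun j hj => (hadj' j hj).trans (hadj j hj).symm)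
        (h.trans hA.symm)
  rw [Finset.sum_pair hneL] at hsum
  have hmem : flagCoeff z L ∈ L₁.space i.succ := by
    rw [← Submodule.restrictScalars_mem ℤ,
      ← Submodule.smul_mem_iff_of_isUnit _ (LocalSystem.isUnit_vertexSign _ _),
      eq_neg_of_add_eq_zero_left hsum]
    exact neg_mem (zsmul_mem (flagCoeff_mem z L₁ i) _)
  exact hne ((L₁.space_eq_span_singleton hi hmem hL).trans
    (L.space_eq_span_singleton hi (flagCoeff_mem z L i) hL).symm)

end Cycles

/-! ### Generic flags in the support of a cycle -/

namespace CompleteFlag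

/-- From codimension `i` on, each member of `L` is cut out of the preceding one by a linear form in
`e_j + ⟨e_{j+1}, …, e_n⟩`, but not by `e_j` itself. For the coordinate forms and `i = 0` these are
the flags `⟨v₁⟩^⊥ ⊃ ⟨v₁, v₂⟩^⊥ ⊃ ⋯` with `v` in the index set `T_{q,n}`. -/
def IsGeneric (e : Fin (m + 1) → Dual F (Fin (m + 1) → F)) (i : Fin (m + 1))
    (L : CompleteFlag F m) : Prop :=
  ∀ j : Fin m, i ≤ j.castSucc →
    (∃ φ : Dual F (Fin (m + 1) → F),
      φ - e j.castSucc ∈ Submodule.span F (e '' Set.Ioi j.castSucc) ∧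
        L.space j.succ = L.space j.castSucc ⊓ LinearMap.ker φ) ∧
      L.space j.succ ≠ L.space j.castSucc ⊓ LinearMap.ker (e j.castSucc)

end CompleteFlag

open CompleteFlag

/-- The linear forms `e_i, …, e_n` have no common zero in `U`. -/
def SeparatesFrom (e : Fin (m + 1) → Dual F (Fin (m + 1) → F)) (i : Fin (m + 1))
    (U : Submodule F (Fin (m + 1) → F)) : Prop :=
  ∀ u ∈ U, e i u = 0 → (∀ j ∈ Set.Ioi i, e j u = 0) → u = 0

/-- Every complete flag in the support of `z` can be changed beyond codimension `i` into a generic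
one in the support. -/
def GenericExtension (z : (taut F m).Chain m) (i : Fin (m + 1)) : Prop :=
  ∀ (e : Fin (m + 1) → Dual F (Fin (m + 1) → F)) (L : CompleteFlag F m),
    SeparatesFrom e i (L.space i) → flagCoeff z L ≠ 0 →
      ∃ L' : CompleteFlag F m, (∀ j ≤ i, L'.space j = L.space j) ∧ IsGeneric e i L' ∧
        flagCoeff z L' ≠ 0

theorem apply_eq_of_sub_mem_span {ι V : Type*} [AddCommGroup V] [Module F V]
    {e : ι → Dual F V} {s : Set ι} {φ ψ : Dual F V} (h : φ - ψ ∈ Submodule.span F (e '' s)) {u : V}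
    (hu : ∀ j ∈ s, e j u = 0) : φ u = ψ u := by
  have hle : Submodule.span F (e '' s) ≤ LinearMap.ker (Dual.eval F V u) := by
    rw [Submodule.span_le]
    rintro _ ⟨j, hj, rfl⟩
    exact hu j hj
  exact sub_eq_zero.1 (hle h)

theorem ncard_Ioi_add_one (i : Fin (m + 1)) : (Set.Ioi i).ncard + i = m := by
  rw [← Finset.coe_Ioi, Set.ncard_coe_finset, Fin.card_Ioi]
  omega

section Extension

variable {z : (taut F m).Chain m} {i : Fin m} {e : Fin (m + 1) → Dual F (Fin (m + 1) → F)}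
  {L : CompleteFlag F m} {f : Fin (m + 1) → F}

theorem exists_isGeneric_of_notMem (ih : GenericExtension z i.succ)
    (hsep : SeparatesFrom e i.castSucc (L.space i.castSucc)) (hL : flagCoeff z L ≠ 0)
    (hf : f ∈ L.space i.castSucc) (hfi : e i.castSucc f = 1)
    (hfs : ∀ j ∈ Set.Ioi i.castSucc, e j f = 0) (hfL : f ∉ L.space i.succ)
    (hne : L.space i.succ ≠ L.space i.castSucc ⊓ LinearMap.ker (e i.castSucc)) :
    ∃ L' : CompleteFlag F m, (∀ j ≤ i.castSucc, L'.space j = L.space j) ∧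
      IsGeneric e i.castSucc L' ∧ flagCoeff z L' ≠ 0 := by
  obtain ⟨φ, hφ, hLφ⟩ := exists_eq_inf_ker (L.space_succ_le i) (L.finrank_succ_add_one i) hsep hf
    hfL hfi hfs
  have hsep' : SeparatesFrom e i.succ (L.space i.succ) := by
    intro u hu hu1 hus
    have hus' : ∀ j ∈ Set.Ioi i.castSucc, e j u = 0 := fun j hj =>
      (Fin.castSucc_lt_iff_succ_le.1 hj).eq_or_lt.elim (fun h => h ▸ hu1) (hus j)
    have huφ : φ u = 0 := (hLφ.le hu).2
    exact hsep u (L.space_succ_le i hu) ((apply_eq_of_sub_mem_span hφ hus').symm.trans huφ) hus'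
  obtain ⟨L', hagree, hgen, hL'⟩ := ih e L hsep' hL
  have hlt := Fin.castSucc_lt_succ (i := i)
  refine ⟨L', fun j hj => hagree j (hj.trans hlt.le), fun j hj => ?_, hL'⟩
  obtain rfl | hij := hj.eq_or_lt.imp_left (Fin.castSucc_injective m ·)
  · rw [hagree _ le_rfl, hagree _ hlt.le]
    exact ⟨⟨φ, hφ, hLφ⟩, hne⟩
  · exact hgen j (Fin.castSucc_lt_iff_succ_le.1 hij)

theorem exists_adjacent_notMem_of_last (hz : z ∈ (taut F m).cycles m) (hL : flagCoeff z L ≠ 0)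
    (hi : i.succ = Fin.last m) (A : Submodule F (Fin (m + 1) → F)) (hf0 : f ≠ 0)
    (hfL : f ∈ L.space i.succ) :
    ∃ L', L.IsAdjacent i L' ∧ f ∉ L'.space i.succ ∧ L'.space i.succ ≠ A ∧ flagCoeff z L' ≠ 0 := by
  obtain ⟨L', hadj, hne, hA, hL'⟩ := exists_adjacent_flagCoeff_ne_zero_of_last hz hL hi (A := A)
  refine ⟨L', hadj, fun hfL' => hne ?_, hA, hL'⟩
  rw [L'.space_eq_span_singleton hi hfL' hf0, L.space_eq_span_singleton hi hfL hf0]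

theorem exists_separatesFrom_of_mem {U : Submodule F (Fin (m + 1) → F)}
    {ψ : Dual F (Fin (m + 1) → F)} (hU : finrank F U + i.succ = m + 1) (hf : f ∈ U)
    (hψ : ψ f = 1) :
    ∃ e, e i.succ = ψ ∧ (∀ j ∈ Set.Ioi i.succ, e j f = 0) ∧ SeparatesFrom e i.succ U := by
  refine exists_separating_of_apply_eq_one hψ Set.self_notMem_Ioi ?_
  have hker := finrank_inf_ker_add_one hf (hψ.trans_ne one_ne_zero)
  have hcard := ncard_Ioi_add_one i.succ
  omega

theorem exists_adjacent_notMem_of_generic (hz : z ∈ (taut F m).cycles m) (hL : flagCoeff z L ≠ 0)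
    {k : Fin m} (hk : k.castSucc = i.succ) (hgen : IsGeneric e i.succ L)
    (hfL : f ∈ L.space i.succ) (hfi : e i.succ f = 1) (hfs : ∀ j ∈ Set.Ioi i.succ, e j f = 0) :
    ∃ L', L.IsAdjacent i L' ∧ f ∉ L'.space i.succ ∧
      ¬ L'.space i.succ ≤ LinearMap.ker (e i.succ) ∧ flagCoeff z L' ≠ 0 := by
  obtain ⟨⟨φ, hφ, hLφ⟩, hLe⟩ := hgen k hk.ge
  have hLk := L.finrank_succ_add_one k
  rw [hk] at hφ hLφ hLe hLk
  have hφf : φ f = 1 := (apply_eq_of_sub_mem_span hφ hfs).trans hfi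
  have hfk : f ∉ L.space k.succ := fun h =>
    one_ne_zero (hφf.symm.trans (LinearMap.mem_ker.1 (hLφ.le h).2))
  obtain ⟨L', hadj, hne, hL'⟩ := exists_adjacent_flagCoeff_ne_zero hz hL i
  have hkk : L'.space k.succ = L.space k.succ := hadj _ (hk ▸ Fin.castSucc_lt_succ.ne')
  have hle : L.space k.succ ≤ L.space i.succ := hk ▸ L.space_succ_le k
  have hle' : L.space k.succ ≤ L'.space i.succ := hkk ▸ hk ▸ L'.space_succ_le k
  have hLk' : finrank F (L.space k.succ) + 1 = finrank F (L'.space i.succ) :=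
    hkk ▸ hk ▸ L'.finrank_succ_add_one k
  refine ⟨L', hadj, fun hfL' => hne ?_, fun hker => hLe ?_, hL'⟩
  · rw [← sup_span_singleton_eq hle' hLk' hfL' hfk, sup_span_singleton_eq hle hLk hfL hfk]
  · exact eq_inf_ker_of_le hle hLk (hle'.trans hker) hfL (hfi.trans_ne one_ne_zero)

theorem exists_notMem_of_mem (hz : z ∈ (taut F m).cycles m) (ih : GenericExtension z i.succ)
    (hL : flagCoeff z L ≠ 0) (hfL : f ∈ L.space i.succ) {ψ : Dual F (Fin (m + 1) → F)}
    (hψ : ψ f = 1) :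
    ∃ L' : CompleteFlag F m, (∀ j ≤ i.castSucc, L'.space j = L.space j) ∧
      f ∉ L'.space i.succ ∧ L'.space i.succ ≠ L.space i.castSucc ⊓ LinearMap.ker ψ ∧
        flagCoeff z L' ≠ 0 := by
  have hne : ∀ j ≤ i.castSucc, j ≠ i.succ := fun j hj => (hj.trans_lt Fin.castSucc_lt_succ).ne
  by_cases hi : i.succ = Fin.last m
  · have hf0 : f ≠ 0 := by
      rintro rfl
      exact zero_ne_one ((map_zero ψ).symm.trans hψ)
    obtain ⟨L', hadj, hfL', hA, hL'⟩ := exists_adjacent_notMem_of_last hz hL hi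
      (L.space i.castSucc ⊓ LinearMap.ker ψ) hf0 hfL
    exact ⟨L', fun j hj => hadj j (hne j hj), hfL', hA, hL'⟩
  · obtain ⟨k, hk⟩ := Fin.exists_castSucc_eq.2 hi
    obtain ⟨e, he, hes, hsep⟩ := exists_separatesFrom_of_mem (L.finrank_add i.succ) hfL hψ
    obtain ⟨L₁, hagree, hgen, hL₁⟩ := ih e L hsep hL
    obtain ⟨L', hadj, hfL', hker, hL'⟩ := exists_adjacent_notMem_of_generic hz hL₁ hk hgen
      (hagree _ le_rfl ▸ hfL) (he ▸ hψ) hes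
    exact ⟨L', fun j hj => (hadj j (hne j hj)).trans
        (hagree j (hj.trans Fin.castSucc_lt_succ.le)), hfL',
      fun h => hker (he ▸ h.le.trans inf_le_right), hL'⟩

theorem exists_notMem_ne (hz : z ∈ (taut F m).cycles m) (ih : GenericExtension z i.succ)
    (hL : flagCoeff z L ≠ 0) {ψ : Dual F (Fin (m + 1) → F)} (hψ : ψ f = 1) :
    ∃ L' : CompleteFlag F m, (∀ j ≤ i.castSucc, L'.space j = L.space j) ∧
      f ∉ L'.space i.succ ∧ L'.space i.succ ≠ L.space i.castSucc ⊓ LinearMap.ker ψ ∧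
        flagCoeff z L' ≠ 0 := by
  obtain ⟨L₁, hagree, hL₁A, hL₁⟩ : ∃ L₁ : CompleteFlag F m,
      (∀ j ≤ i.castSucc, L₁.space j = L.space j) ∧
        L₁.space i.succ ≠ L.space i.castSucc ⊓ LinearMap.ker ψ ∧ flagCoeff z L₁ ≠ 0 := by
    by_cases hLA : L.space i.succ = L.space i.castSucc ⊓ LinearMap.ker ψ
    · obtain ⟨L₁, hadj, hne, hL₁⟩ := exists_adjacent_flagCoeff_ne_zero hz hL i
      exact ⟨L₁, fun j hj => hadj j (hj.trans_lt Fin.castSucc_lt_succ).ne, hLA ▸ hne, hL₁⟩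
    · exact ⟨L, fun _ _ => rfl, hLA, hL⟩
  by_cases hfL₁ : f ∈ L₁.space i.succ
  · obtain ⟨L', hagree', hfL', hL'A, hL'⟩ := exists_notMem_of_mem hz ih hL₁ hfL₁ hψ
    exact ⟨L', fun j hj => (hagree' j hj).trans (hagree j hj), hfL', hagree _ le_rfl ▸ hL'A, hL'⟩
  · exact ⟨L₁, hagree, hfL₁, hL₁A, hL₁⟩

theorem genericExtension_castSucc (hz : z ∈ (taut F m).cycles m)
    (ih : GenericExtension z i.succ) : GenericExtension z i.castSucc := by
  intro e L hsep hL
  have hcard : (Set.Ioi i.castSucc).ncard < finrank F (L.space i.castSucc) := by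
    have h1 := ncard_Ioi_add_one i.castSucc
    have h2 := L.finrank_add i.castSucc
    omega
  obtain ⟨f, hf, hfi, hfs⟩ := exists_mem_dual_vector hsep hcard
  obtain ⟨L₁, hagree, hfL₁, hL₁A, hL₁⟩ := exists_notMem_ne hz ih hL hfi
  rw [← hagree _ le_rfl] at hsep hf hL₁A
  obtain ⟨L', hagree', hgen, hL'⟩ := exists_isGeneric_of_notMem ih hsep hL₁ hf hfi hfs hfL₁ hL₁A
  exact ⟨L', fun j hj => (hagree' j hj).trans (hagree j hj), hgen, hL'⟩

theorem genericExtension (hz : z ∈ (taut F m).cycles m) (i : Fin (m + 1)) :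
    GenericExtension z i := by
  induction i using Fin.reverseInduction with
  | last =>
    exact fun e L _ hL => ⟨L, fun _ _ => rfl, fun j hj =>
      absurd hj (not_le.2 (Fin.castSucc_lt_last j)), hL⟩
  | cast i ih => exact genericExtension_castSucc hz ih

end Extension

/-! ### The classes of the `c_v` form a basis -/

/-- The vertices `a_1^{ε_1}, …, a_{n-1}^{ε_{n-1}}, b` of `K`, indexed by their positions. -/
def vertexAt (ε : Fin m → Bool) : Fin (m + 1) → Vertex m :=
  Fin.lastCases Vertex.b (seqA ε)

theorem vertexAt_castSucc (ε : Fin m → Bool) (i : Fin m) :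
    vertexAt ε i.castSucc = Vertex.a i (ε i) :=
  Fin.lastCases_castSucc (motive := fun _ => Vertex m) i

theorem pos_vertexAt (ε : Fin m → Bool) (p : Fin (m + 1)) : (vertexAt ε p).pos = p := by
  cases p using Fin.lastCases with
  | last => simp [vertexAt, Vertex.pos]
  | cast i => simp [vertexAt, Vertex.pos, seqA]

theorem theta_vertexAt_of_le {v : IndexT F m} {ε : Fin m → Bool} {i p : Fin (m + 1)}
    (hε : ∀ j : Fin m, i ≤ j.castSucc → ε j = false) (hp : i ≤ p) :
    theta v (vertexAt ε p) = stdVec F p := by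
  cases p using Fin.lastCases with
  | last => simp [vertexAt, theta]
  | cast j => rw [vertexAt_castSucc, hε j hp, theta]

theorem eq_zero_of_dot_theta_vertexAt (v : IndexT F m) (ε : Fin m → Bool) {u : Fin (m + 1) → F}
    (h : ∀ p, u ⬝ᵥ theta v (vertexAt ε p) = 0) : u = 0 := by
  have hdet : (Matrix.of fun p => theta v (vertexAt ε p)).det = 1 := by
    rw [Matrix.det_of_isUpperTriangular (M := Matrix.of fun p => theta v (vertexAt ε p))
      fun p q hqp => theta_lower v _ (lt_of_lt_of_eq hqp (pos_vertexAt ε p).symm)]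
    refine Finset.prod_eq_one fun p _ => ?_
    simpa only [Matrix.of_apply, pos_vertexAt] using theta_pos v (vertexAt ε p)
  refine Matrix.eq_zero_of_mulVec_eq_zero (hdet.trans_ne one_ne_zero) ?_
  funext p
  exact (dotProduct_comm _ _).trans (h p)

theorem exists_dual_coordinate (v : IndexT F m) {i p : Fin (m + 1)} (hp : i ≤ p) :
    ∃ w : Fin (m + 1) → F, (∀ j : Fin m, j.castSucc < i → w ⬝ᵥ v.1 j = 0) ∧
      ∀ t : Fin (m + 1) → F, (∀ q < i, t q = 0) → w ⬝ᵥ t = t p := by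
  let ε : Fin m → Bool := fun j => decide (j.castSucc < i)
  have hpos : Set.InjOn Vertex.pos
      ((Finset.univ.image (vertexAt ε) : Finset (Vertex m)) : Set (Vertex m)) := by
    rw [Finset.coe_image, Finset.coe_univ, Set.image_univ]
    rintro _ ⟨p, rfl⟩ _ ⟨q, rfl⟩ h
    rw [pos_vertexAt, pos_vertexAt] at h
    rw [h]
  obtain ⟨w, -, hw⟩ := exists_dual v hpos p
  have hw' : ∀ q, w ⬝ᵥ theta v (vertexAt ε q) = if q = p then 1 else 0 := fun q => by
    rw [hw _ (Finset.mem_image_of_mem _ (Finset.mem_univ q)), pos_vertexAt]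
  refine ⟨w, fun j hj => ?_, fun t ht => ?_⟩
  · have h := hw' j.castSucc
    rwa [vertexAt_castSucc, show ε j = true from decide_eq_true hj,
      if_neg (hj.trans_le hp).ne] at h
  · have hcoord : ∀ q, i ≤ q → w q = if q = p then 1 else 0 := fun q hq => by
      rw [← hw' q, theta_vertexAt_of_le (fun j hj => decide_eq_false hj.not_gt) hq, stdVec,
        dotProduct_single, mul_one]
    rw [dotProduct, Finset.sum_eq_single_of_mem p (Finset.mem_univ p) fun q _ hq => ?_,
      hcoord p hp, if_pos rfl, one_mul]
    rcases lt_or_ge q i with h | h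
    · rw [ht q h, mul_zero]
    · rw [hcoord q h, if_neg hq, zero_mul]

theorem theta_eq_of_perp_le (v : IndexT F m) (u : IndexT F m) {i : Fin m} {x : Vertex m}
    (hx : i.castSucc ≤ x.pos)
    (h : ∀ w : Fin (m + 1) → F, (∀ j < i, w ⬝ᵥ u.1 j = 0) → w ⬝ᵥ u.1 i = 0 →
      w ⬝ᵥ theta v x = 0) :
    x.pos = i.castSucc ∧ theta v x = u.1 i := by
  have hyl : ∀ q < i.castSucc, theta v x q = 0 := fun q hq => theta_lower v x (hq.trans_le hx)
  have hul : ∀ q < i.castSucc, u.1 i q = 0 := fun q hq => theta_lower u (.a i true) hq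
  have hui : u.1 i i.castSucc = 1 := theta_pos u (.a i true)
  have hsmul : ∀ p, theta v x p = theta v x i.castSucc * u.1 i p := by
    intro p
    rcases lt_or_ge p i.castSucc with hp | hp
    · rw [hyl p hp, hul p hp, mul_zero]
    · obtain ⟨w, hw, hwt⟩ := exists_dual_coordinate u hp
      obtain ⟨w₀, hw₀, hwt₀⟩ := exists_dual_coordinate u (le_refl i.castSucc)
      have hdot := h (w - u.1 i p • w₀) (fun j hj => ?_) ?_
      · rwa [sub_dotProduct, smul_dotProduct, hwt _ hyl, hwt₀ _ hyl, smul_eq_mul, mul_comm,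
          sub_eq_zero] at hdot
      · rw [sub_dotProduct, smul_dotProduct, hw j hj, hw₀ j hj, smul_zero, sub_zero]
      · rw [sub_dotProduct, smul_dotProduct, hwt _ hul, hwt₀ _ hul, hui, smul_eq_mul, mul_one,
          sub_self]
  have hpos : x.pos = i.castSucc := by
    refine (hx.eq_of_not_lt fun hlt => one_ne_zero (α := F) ?_).symm
    rw [← theta_pos v x, hsmul, theta_lower v x hlt, zero_mul]
  refine ⟨hpos, funext fun p => ?_⟩
  rw [hsmul, ← hpos, theta_pos, one_mul]

/-- The simplex `⟨v₁⟩^⊥ ⊃ ⟨v₁, v₂⟩^⊥ ⊃ ⋯` of the building, at which `c̃_u` has a nonzero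
coefficient only for `u = v`. -/
def baseFlag (v : IndexT F m) : (building F m).Simplex m :=
  (fMap v).mapSimplex (flagSimplex (seqA (fun _ => true) ∘ (1 : Equiv.Perm (Fin m)))
    (seqA_mem _ 1) ((seqA_injective _).comp (Equiv.injective (1 : Equiv.Perm (Fin m)))))

theorem mem_fVertex_prefixVertex (v : IndexT F m) (x : Fin m → Vertex m)
    (hx : Finset.univ.image x ∈ (coneComplex m).faces) (i : Fin m) (w : Fin (m + 1) → F) :
    w ∈ (fVertex v (prefixVertex x hx i)).val ↔ ∀ j ≤ i, w ⬝ᵥ theta v (x j) = 0 := by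
  refine (mem_perpTheta v _ w).trans ?_
  simp [prefixVertex]

theorem mem_mapSimplex_flagSimplex (v : IndexT F m) (x : Fin m → Vertex m)
    (hx : Finset.univ.image x ∈ (coneComplex m).faces) (hinj : Function.Injective x)
    (B : ProperSubspace F m) :
    B ∈ ((fMap v).mapSimplex (flagSimplex x hx hinj)).1.1 ↔
      ∃ i, fVertex v (prefixVertex x hx i) = B := by
  change B ∈ (Finset.univ.image (prefixVertex x hx)).image (fVertex v) ↔ _
  simp

theorem strictAnti_fVertex_prefixVertex (v : IndexT F m) {x : Fin m → Vertex m}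
    (hx : Finset.univ.image x ∈ (coneComplex m).faces) (hinj : Function.Injective x) :
    StrictAnti fun i => fVertex v (prefixVertex x hx i) := fun i j hij => by
  refine fVertex_lt v ?_
  change (Finset.Iic i).image x ⊂ (Finset.Iic j).image x
  rwa [Finset.image_ssubset_image hinj, Finset.Iic_ssubset_Iic]

section BaseFlag

variable {v u : IndexT F m}

theorem perp_iff_of_mapSimplex_eq_baseFlag {x : Fin m → Vertex m}
    (hx : Finset.univ.image x ∈ (coneComplex m).faces) (hinj : Function.Injective x)
    (h : (fMap v).mapSimplex (flagSimplex x hx hinj) = baseFlag u) (i : Fin m)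
    (w : Fin (m + 1) → F) :
    (∀ j ≤ i, w ⬝ᵥ theta v (x j) = 0) ↔ ∀ j ≤ i, w ⬝ᵥ u.1 j = 0 := by
  have hrange : Set.range (fun i => fVertex v (prefixVertex x hx i)) =
      Set.range fun i => fVertex u (prefixVertex _ (seqA_mem (fun _ => true) 1) i) := by
    ext B
    rw [Set.mem_range, Set.mem_range, ← mem_mapSimplex_flagSimplex v x hx hinj, h]
    exact mem_mapSimplex_flagSimplex u _ _ _ B
  have hfun := (StrictMono.range_inj (strictAnti_fVertex_prefixVertex v hx hinj).dual_right
    (strictAnti_fVertex_prefixVertex u (seqA_mem (fun _ => true) 1)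
      ((seqA_injective _).comp (Equiv.injective _))).dual_right).1 hrange
  have hi : fVertex v (prefixVertex x hx i) = fVertex u (prefixVertex _ _ i) := congrFun hfun i
  rw [← mem_fVertex_prefixVertex v x hx, hi]
  exact mem_fVertex_prefixVertex u _ _ i w

theorem eq_of_mapSimplex_eq_baseFlag {x : Fin m → Vertex m}
    (hx : Finset.univ.image x ∈ (coneComplex m).faces) (hinj : Function.Injective x)
    (h : (fMap v).mapSimplex (flagSimplex x hx hinj) = baseFlag u) (i : Fin m) :
    x i = Vertex.a i true ∧ v.1 i = u.1 i := by
  induction i using WellFoundedLT.induction with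
  | ind i ih =>
    have hpos : i.castSucc ≤ (x i).pos := by
      by_contra! hlt
      obtain ⟨j, hj⟩ := Fin.exists_castSucc_eq.2 (hlt.trans_le (Fin.le_last _)).ne
      have hji : j < i := Fin.castSucc_lt_castSucc_iff.1 (hj.trans_lt hlt)
      have hxj : (x j).pos = (x i).pos := by rw [(ih j hji).1, ← hj, Vertex.pos]
      exact hji.ne (hinj (pos_injOn hx (by simp) (by simp) hxj))
    obtain ⟨hxi, hθ⟩ := theta_eq_of_perp_le v u hpos fun w hw hwi =>
      (perp_iff_of_mapSimplex_eq_baseFlag hx hinj h i w).2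
        (fun j hj => hj.lt_or_eq.elim (hw j) fun e => e ▸ hwi) i le_rfl
    match hv : x i with
    | .b =>
      rw [hv] at hxi
      exact absurd hxi.symm (Fin.castSucc_lt_last i).ne
    | .a j ε =>
      rw [hv] at hxi hθ
      obtain rfl : j = i := Fin.castSucc_injective m hxi
      match ε with
      | false => exact absurd hθ.symm (u.2 j).2
      | true => exact ⟨rfl, hθ⟩

theorem mapSimplex_seqAB_ne_baseFlag (j : Fin m) (ε : Fin m → Bool) (π : Equiv.Perm (Fin m)) :
    (fMap v).mapSimplex (flagSimplex (seqAB ε j ∘ π) (seqAB_mem ε j π)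
      ((seqAB_injective ε j).comp π.injective)) ≠ baseFlag u := fun h => by
  have := (eq_of_mapSimplex_eq_baseFlag _ _ h (π.symm j)).1
  simp [seqAB] at this

theorem mapSimplex_seqA_eq_baseFlag_iff (ε : Fin m → Bool) (π : Equiv.Perm (Fin m)) :
    (fMap v).mapSimplex (flagSimplex (seqA ε ∘ π) (seqA_mem ε π)
      ((seqA_injective ε).comp π.injective)) = baseFlag u ↔
        ε = (fun _ => true) ∧ π = 1 ∧ v = u := by
  refine ⟨fun h => ?_, ?_⟩
  · have hxv := eq_of_mapSimplex_eq_baseFlag _ _ h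
    simp only [Function.comp_apply, seqA, Vertex.a.injEq] at hxv
    obtain rfl : π = 1 := Equiv.ext fun i => (hxv i).1.1
    exact ⟨funext fun i => (hxv i).1.2, rfl, Subtype.ext (funext fun i => (hxv i).2)⟩
  · rintro ⟨rfl, rfl, rfl⟩
    rfl

theorem baseFlag_injective : Function.Injective (baseFlag (F := F) (m := m)) := fun _ _ h =>
  ((mapSimplex_seqA_eq_baseFlag_iff (fun _ => true) 1).1 h).2.2

theorem toFinsupp_chainMap_single (σ : (sd (coneComplex m)).Simplex m)
    (x : (hSystem v).obj σ.1) :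
    (taut F m).toFinsupp tautIncl m ((fMap v).chainMap (taut F m) m ((hSystem v).single σ x))
      (baseFlag u).1.1 = if (fMap v).mapSimplex σ = baseFlag u then x.1 else 0 := by
  rw [OrderedMap.chainMap_single, LocalSystem.toFinsupp_single, Finsupp.single_apply]
  refine if_congr ⟨fun h => ?_, fun h => congrArg (fun τ => τ.1.1) h⟩ rfl rfl
  exact OrderedCpx.Simplex.ext (Subtype.ext h)

theorem toFinsupp_chainMap_cChain :
    (taut F m).toFinsupp tautIncl m ((fMap v).chainMap (taut F m) m (cChain v))
      (baseFlag u).1.1 = if v = u then (-1 : ℤ) ^ m • wVec (seqV v fun _ => true) else 0 := by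
  let Λ : (hSystem v).Chain m →ₗ[F] Fin (m + 1) → F :=
    Finsupp.lapply (baseFlag u).1.1 ∘ₗ (taut F m).toFinsupp tautIncl m ∘ₗ
      (fMap v).chainMap (taut F m) m
  have hΛ : ∀ σ x, Λ ((hSystem v).single σ x) =
      if (fMap v).mapSimplex σ = baseFlag u then x.1 else 0 := toFinsupp_chainMap_single
  change Λ (cChain v) = _
  simp only [cChain, map_add, map_sum, map_zsmul, hΛ, mapSimplex_seqAB_ne_baseFlag, if_false,
    smul_zero, Finset.sum_const_zero, add_zero, mapSimplex_seqA_eq_baseFlag_iff, ite_and]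
  rw [Finset.sum_eq_single (fun _ => true), Finset.sum_eq_single 1]
  · simp [chi, coeffA]
  all_goals simp +contextual

end BaseFlag

section GenericFlags

variable {L : CompleteFlag F m}

theorem exists_indexT_space_eq_inf_ker (hL : L.IsGeneric (fun p => LinearMap.proj p) 0) :
    ∃ v : IndexT F m, ∀ j : Fin m,
      L.space j.succ = L.space j.castSucc ⊓ LinearMap.ker (dotProductEquiv F _ (v.1 j)) := by
  have hstd : ∀ p, dotProductEquiv F (Fin (m + 1)) (stdVec F p) = LinearMap.proj p := fun p =>
    LinearMap.ext fun u => single_one_dotProduct p u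
  choose φ hφ hspace using fun j => (hL j (Fin.zero_le _)).1
  let w : Fin m → Fin (m + 1) → F := fun j => (dotProductEquiv F _).symm (φ j)
  have hw : ∀ j, dotProductEquiv F _ (w j) = φ j := fun j => LinearEquiv.apply_symm_apply _ _
  refine ⟨⟨w, fun j => ⟨?_, fun hwj => (hL j (Fin.zero_le _)).2 ?_⟩⟩, fun j => ?_⟩
  · have hspan : Submodule.span F ((fun p => LinearMap.proj p) '' Set.Ioi j.castSucc) =
        (Submodule.span F (stdVec F '' Set.Ioi j.castSucc)).map
          (dotProductEquiv F (Fin (m + 1))).toLinearMap := by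
      rw [Submodule.map_span, Set.image_image]
      simp only [LinearEquiv.coe_coe, hstd]
    have hφj : φ j - dotProductEquiv F _ (stdVec F j.castSucc) ∈
        (Submodule.span F (stdVec F '' Set.Ioi j.castSucc)).map
          (dotProductEquiv F (Fin (m + 1))).toLinearMap := by
      rw [hstd, ← hspan]
      exact hφ j
    rwa [Submodule.mem_map_equiv, map_sub, LinearEquiv.symm_apply_apply] at hφj
  · rw [hspace, ← hw, hwj, hstd]
  · rw [hspace, hw]

theorem mem_space_iff {v : IndexT F m} (hv : ∀ j : Fin m,
      L.space j.succ = L.space j.castSucc ⊓ LinearMap.ker (dotProductEquiv F _ (v.1 j)))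
    (i : Fin (m + 1)) {u : Fin (m + 1) → F} :
    u ∈ L.space i ↔ ∀ j : Fin m, j.castSucc < i → u ⬝ᵥ v.1 j = 0 := by
  induction i using Fin.induction with
  | zero => simp [L.space_zero]
  | succ i ih =>
    rw [hv, Submodule.mem_inf, ih, LinearMap.mem_ker, dotProductEquiv_apply_apply, dotProduct_comm]
    simp only [Fin.castSucc_lt_succ_iff, Fin.castSucc_lt_castSucc_iff]
    refine ⟨fun h j hj => hj.lt_or_eq.elim (h.1 j) fun e => e ▸ h.2,
      fun h => ⟨fun j hj => h j hj.le, h i le_rfl⟩⟩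

theorem exists_chamber_eq_baseFlag (hL : L.IsGeneric (fun p => LinearMap.proj p) 0) :
    ∃ v : IndexT F m, L.chamber = baseFlag v := by
  obtain ⟨v, hv⟩ := exists_indexT_space_eq_inf_ker hL
  have hvertex : ∀ i, fVertex v (prefixVertex _ (seqA_mem (fun _ => true) 1) i) = L.member i := by
    refine fun i => ProperSubspace.ext (Submodule.ext fun u => ?_)
    refine (mem_fVertex_prefixVertex v _ _ i u).trans (Iff.trans ?_ (mem_space_iff hv i.succ).symm)
    simp [Fin.castSucc_lt_succ_iff, seqA, theta]
  refine ⟨v, OrderedCpx.Simplex.ext (Subtype.ext (Finset.ext fun B => ?_))⟩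
  refine CompleteFlag.mem_chamber.trans (Iff.trans ?_ (mem_mapSimplex_flagSimplex v _ _ _ B).symm)
  simp only [hvertex]

end GenericFlags

theorem eq_zero_of_toFinsupp_baseFlag_eq_zero {z : (taut F m).Chain m}
    (hz : z ∈ (taut F m).cycles m)
    (h : ∀ v, (taut F m).toFinsupp tautIncl m z (baseFlag v).1.1 = 0) : z = 0 := by
  refine eq_zero_of_flagCoeff_eq_zero fun L => ?_
  by_contra hL
  have hsep : SeparatesFrom (fun p => LinearMap.proj p) 0 (L.space 0) := fun u _ h0 hpos =>
    funext fun p => p.zero_le.eq_or_lt.elim (fun e => e ▸ h0) (hpos p)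
  obtain ⟨L', -, hgen, hL'⟩ := genericExtension hz 0 _ L hsep hL
  obtain ⟨v, hv⟩ := exists_chamber_eq_baseFlag hgen
  exact hL' (by rw [flagCoeff, hv, h])

theorem toFinsupp_baseFlag_eq_zero {z : (taut F m).Chain m} {v : IndexT F m}
    (h : (taut F m).toFinsupp tautIncl m z (baseFlag v).1.1 (Fin.last m) = 0) :
    (taut F m).toFinsupp tautIncl m z (baseFlag v).1.1 = 0 := by
  refine eq_zero_of_dot_theta_vertexAt v (fun _ => true) fun p => ?_
  cases p using Fin.lastCases with
  | last => simpa [vertexAt, theta, stdVec] using h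
  | cast j =>
    rw [LocalSystem.toFinsupp_apply, vertexAt_castSucc]
    exact (mem_fVertex_prefixVertex v _ _ j _).1
      ((z (baseFlag v)).2 _ ((mem_mapSimplex_flagSimplex v _ _ _ _).2 ⟨j, rfl⟩)) j le_rfl

variable (F m) in
/-- The last coordinates of the coefficients of a chain at the simplices `baseFlag v`, with the
sign `(-1) ^ m = χ(1, id)` that normalizes the coordinates of the cycles `c̃_v`. -/
def baseCoords : (taut F m).Chain m →ₗ[F] IndexT F m →₀ F :=
  (-1 : ℤ) ^ m • Finsupp.mapRange.linearMap (LinearMap.proj (Fin.last m)) ∘ₗ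
    Finsupp.lcomapDomain (fun v => (baseFlag v).1.1)
      (fun _ _ h => baseFlag_injective (OrderedCpx.Simplex.ext (Subtype.ext h))) ∘ₗ
    (taut F m).toFinsupp tautIncl m

theorem baseCoords_apply (z : (taut F m).Chain m) (v : IndexT F m) :
    baseCoords F m z v =
      (-1 : ℤ) ^ m • (taut F m).toFinsupp tautIncl m z (baseFlag v).1.1 (Fin.last m) := rfl

theorem baseCoords_chainMap_cChain (v : IndexT F m) :
    baseCoords F m ((fMap v).chainMap (taut F m) m (cChain v)) = Finsupp.single v 1 := by
  ext u
  have hlast : wVec (seqV v fun _ => true) (Fin.last m) = 1 := by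
    simpa [stdVec] using (wVec_seqV v fun _ => true).2
  rw [baseCoords_apply, toFinsupp_chainMap_cChain, Finsupp.single_apply]
  split_ifs with h
  · rw [Pi.smul_apply, hlast, smul_smul, ← mul_pow, neg_one_mul, neg_neg, one_pow, one_smul]
  · rw [Pi.zero_apply, smul_zero]

theorem eq_zero_of_baseCoords_eq_zero {z : (taut F m).Chain m} (hz : z ∈ (taut F m).cycles m)
    (h : baseCoords F m z = 0) : z = 0 := by
  refine eq_zero_of_toFinsupp_baseFlag_eq_zero hz fun v => toFinsupp_baseFlag_eq_zero ?_
  have hv := DFunLike.congr_fun h v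
  rw [baseCoords_apply, Finsupp.zero_apply] at hv
  rcases neg_one_pow_eq_or ℤ m with h1 | h1 <;> simpa [h1] using hv

variable (F m) in
/-- The coordinates `baseCoords` on `D¹(V)`; they are well defined because the chains of degree
`n - 1` vanish. -/
def homologyCoords : D1 F m →ₗ[F] IndexT F m →₀ F :=
  Submodule.liftQ _ (baseCoords F m ∘ₗ ((taut F m).cycles m).subtype) (by
    rintro ⟨z, hz⟩ ⟨d, rfl⟩
    simp [boundary_top_eq_zero])

theorem homologyCoords_injective : Function.Injective (homologyCoords F m) := by
  rw [injective_iff_map_eq_zero]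
  intro a ha
  obtain ⟨⟨z, hz⟩, rfl⟩ := Submodule.Quotient.mk_surjective _ a
  obtain rfl : z = 0 := eq_zero_of_baseCoords_eq_zero hz ha
  rfl

theorem homologyCoords_homologyMap_cChain (v : IndexT F m) :
    homologyCoords F m ((fMap v).homologyMap (taut F m) m
      ((hSystem v).homologyClass (cChain v) (cChain_mem_cycles v))) = Finsupp.single v 1 :=
  baseCoords_chainMap_cChain v

end TwistedBuilding

end

theorem theorem2p2_general (F : Type*) [Field F] (m : ℕ) :
    ∃ hc : ∀ v : TwistedBuilding.IndexT F m,
        TwistedBuilding.cChain v ∈ (TwistedBuilding.hSystem v).cycles m,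
      ∃ B : Module.Basis (TwistedBuilding.IndexT F m) F (TwistedBuilding.D1 F m),
        ∀ v : TwistedBuilding.IndexT F m,
          B v = (TwistedBuilding.fMap v).homologyMap (TwistedBuilding.taut F m) m
            ((TwistedBuilding.hSystem v).homologyClass (TwistedBuilding.cChain v) (hc v)) :=
  ⟨TwistedBuilding.cChain_mem_cycles,
    TwistedBuilding.exists_basis_of_injective_of_map_eq_single
      TwistedBuilding.homologyCoords_injective
      TwistedBuilding.homologyCoords_homologyMap_cChain⟩

/-- With `n = m + 1` and `V = Fⁿ`: every `c_v` is a cycle, and the classes `(f_v)_* c_v`, indexed by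
`v ∈ T_{q,n}`, form a basis of `D¹(V)` over `F`. -/
theorem theorem2p2 (F : Type*) [Field F] [Finite F] (m : ℕ) :
    ∃ hc : ∀ v : TwistedBuilding.IndexT F m,
        TwistedBuilding.cChain v ∈ (TwistedBuilding.hSystem v).cycles m,
      ∃ B : Module.Basis (TwistedBuilding.IndexT F m) F (TwistedBuilding.D1 F m),
        ∀ v : TwistedBuilding.IndexT F m,
          B v = (TwistedBuilding.fMap v).homologyMap (TwistedBuilding.taut F m) m
            ((TwistedBuilding.hSystem v).homologyClass (TwistedBuilding.cChain v) (hc v)) :=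
  theorem2p2_general F m
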